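/- For nonnegative integers $n, m$, a probability distribution $\pi$ on $\{0,\dots,n\}$ and $q\in[0,1]$, let $G$ be the random graph on the node set $\{1,\dots,n\}$ defined as follows. Let $V_1,\dots,V_m$ be independent random subsets of $\{1,\dots,n\}$ with $\mathbb{P}(V_k=A)=\pi(|A|)\binom{n}{|A|}^{-1}$ for every $A\subset\{1,\dots,n\}$. Independently of these, let $C_{e,k}$, for unordered node pairs $e$ and $k=1,\dots,m$, be independent $\{0,1\}$-valued random variables with mean $q$. Distinct nodes $i,j$ are linked in $G$ if and only if there is a $k$ with $i,j\in V_k$ and $C_{\{i,j\},k}=1$. Write $(\pi)_r=\sum_x x(x-1)\cdots(x-r+1)\,\pi(x)$. Consider a sequence of such models with parameters $(n_\nu,m_\nu,\pi_\nu,q_\nu)$ with $n_\nu\to\infty$ as $\nu\to\infty$, in the balanced sparse regime: $m_\nu/n_\nu$, $(\pi_\nu)_1$, $(\pi_\nu)_2$, $(\pi_\nu)_3$ and $q_\nu$ converge to nonzero finite constants. For every $\nu$ let $G^{(n_0)}$ be the subgraph of $G$ induced by a given (deterministic) set of $n_0=n_{0,\nu}$ nodes. Let $N_{K_2}(G^{(n_0)})$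 be its number of links, and let $N_{S_2}(G^{(n_0)})$ and $N_{K_3}(G^{(n_0)})$ be its numbers of (not necessarily induced) subgraphs isomorphic to the 2-star $S_2$ (one centre, two leaves) and to the triangle $K_3$, respectively. Below, $o_{\mathbb P}(1)$ denotes random variables converging to zero in probability as $\nu\to\infty$. **Theorem.** If $\sup_\nu (\pi_\nu)_4<\infty$ and $n_\nu^{1/2}/n_{0,\nu}\to0$, then $$N_{K_2}(G^{(n_0)})=(1+o_{\mathbb P}(1))\,\mathbb{E}N_{K_2}(G^{(n_0)}).$$ If in addition $\sup_\nu (\pi_\nu)_6<\infty$ and $n_\nu^{2/3}/n_{0,\nu}\to0$, then $$N_{S_2}(G^{(n_0)})=(1+o_{\mathbb P}(1))\,\mathbb{E}N_{S_2}(G^{(n_0)}),\qquad N_{K_3}(G^{(n_0)})=(1+o_{\mathbb P}(1))\,\mathbb{E}N_{K_3}(G^{(n_0)}).$$ -/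

import Mathlib

open MeasureTheory ProbabilityTheory Filter Asymptotics
open scoped Topology ENNReal

/-! ## The community model with parameters `(n, m, π, q)` -/

/-- The `r`-th factorial moment `(π)_r = ∑ x, x (x - 1) ⋯ (x - r + 1) π(x)` of a probability
distribution `π` on `{0, …, n}`. -/
noncomputable def factorialMoment {n : ℕ} (π : PMF (Fin (n + 1))) (r : ℕ) : ℝ :=
  ∑ x : Fin (n + 1), ((x : ℕ).descFactorial r : ℝ) * (π x).toReal

/-- The size of a subset of the node set, as an element of `{0, …, n}`. -/
def communitySize {n : ℕ} (A : Finset (Fin n)) : Fin (n + 1) :=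
  ⟨A.card, Nat.lt_succ_of_le (by simpa using A.card_le_univ)⟩

theorem sum_communityDensity {n : ℕ} (π : PMF (Fin (n + 1))) :
    ∑ A : Finset (Fin n), π (communitySize A) / (n.choose A.card : ℝ≥0∞) = 1 := by
  rw [← Finset.sum_fiberwise Finset.univ communitySize]
  have key : ∀ x : Fin (n + 1),
      ∑ A : Finset (Fin n) with communitySize A = x,
        π (communitySize A) / (n.choose A.card : ℝ≥0∞) = π x := by
    intro x
    have h1 : (Finset.univ.filter fun A : Finset (Fin n) => communitySize A = x)
        = Finset.powersetCard (x : ℕ) Finset.univ := by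
      ext A
      simp [communitySize, Fin.ext_iff, Finset.mem_powersetCard]
    have h2 : ∀ A ∈ Finset.univ.filter fun A : Finset (Fin n) => communitySize A = x,
        π (communitySize A) / (n.choose A.card : ℝ≥0∞) = π x / (n.choose (x : ℕ) : ℝ≥0∞) := by
      intro A hA
      have hA' : communitySize A = x := by simpa using hA
      subst hA'
      rfl
    rw [Finset.sum_congr rfl h2, h1, Finset.sum_const, Finset.card_powersetCard,
      Finset.card_univ, Fintype.card_fin, nsmul_eq_mul]
    have h0 : (n.choose (x : ℕ) : ℝ≥0∞) ≠ 0 := by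
      have := Nat.choose_pos (Nat.le_of_lt_succ x.isLt)
      exact_mod_cast this.ne'
    exact ENNReal.mul_div_cancel h0 (ENNReal.natCast_ne_top _)
  rw [Finset.sum_congr rfl fun x _ => key x]
  have := π.tsum_coe
  rwa [tsum_fintype] at this

/-- The law of a community: a random subset of the node set with density
`A ↦ π(|A|) / (n choose |A|)`. -/
noncomputable def communityPMF {n : ℕ} (π : PMF (Fin (n + 1))) : PMF (Finset (Fin n)) :=
  PMF.ofFintype (fun A => π (communitySize A) / (n.choose A.card : ℝ≥0∞))
    (sum_communityDensity π)

/-- The sample space of the model: the communities `V k` for `k < m`, and the symmetric binary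
matrices `C k` for `k < m`, indexed by unordered pairs of nodes. -/
abbrev ModelSpace (n m : ℕ) : Type :=
  (Fin m → Finset (Fin n)) × (Fin m → Sym2 (Fin n) → Bool)

/-- The law of the model: all communities `V k` and all entries `C k e` are independent, every
`V k` has density `A ↦ π(|A|) / (n choose |A|)`, and every `C k e` is Bernoulli with mean `q`. -/
noncomputable def modelMeasure (n m : ℕ) (π : PMF (Fin (n + 1))) (q : unitInterval) :
    Measure (ModelSpace n m) :=
  (Measure.pi fun _ : Fin m => (communityPMF π).toMeasure).prod
    (Measure.pi fun _ : Fin m => Measure.pi fun _ : Sym2 (Fin n) => bernoulliMeasure true false q)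

/-- The random graph `G`: distinct nodes `i`, `j` are linked if and only if, for some `k`, both
belong to the community `V k` and `C k s(i, j) = 1`. -/
def modelGraph {n m : ℕ} (ω : ModelSpace n m) : SimpleGraph (Fin n) where
  Adj i j := i ≠ j ∧ ∃ k, i ∈ ω.1 k ∧ j ∈ ω.1 k ∧ ω.2 k s(i, j) = true
  symm := ⟨by
    rintro i j ⟨hij, k, hi, hj, hC⟩
    exact ⟨hij.symm, k, hj, hi, by rwa [Sym2.eq_swap]⟩⟩
  loopless := ⟨fun _ h => h.1 rfl⟩

/-- The observed graph: the subgraph of `G` induced by the set `S` of observed nodes. -/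
abbrev observedGraph {n m : ℕ} (S : Finset (Fin n)) (ω : ModelSpace n m) :
    SimpleGraph (S : Set (Fin n)) :=
  (modelGraph ω).induce (S : Set (Fin n))

/-- The number of links of the observed graph. -/
noncomputable def linkCount {n m : ℕ} (S : Finset (Fin n)) (ω : ModelSpace n m) : ℝ :=
  ((observedGraph S ω).edgeSet.ncard : ℝ)

/-- The number of (not necessarily induced) subgraphs of the observed graph isomorphic to the
2-star, that is, to the star with one centre and two leaves. -/
noncomputable def twoStarCount {n m : ℕ} (S : Finset (Fin n)) (ω : ModelSpace n m) : ℝ :=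
  ((observedGraph S ω).copyCount (SimpleGraph.starGraph (0 : Fin 3)) : ℝ)

/-- The number of triangles of the observed graph: its subgraphs isomorphic to the
complete graph on three nodes. -/
noncomputable def triangleCount {n m : ℕ} (S : Finset (Fin n)) (ω : ModelSpace n m) : ℝ :=
  ((observedGraph S ω).copyCount (⊤ : SimpleGraph (Fin 3)) : ℝ)

/-! ## Asymptotic notions -/

/-- The balanced sparse regime: `m / n`, `(π)_1`, `(π)_2`, `(π)_3` and `q` converge to nonzero
finite constants as the scale parameter tends to infinity. -/
structure BalancedSparse (n m : ℕ → ℕ) (π : ∀ ν, PMF (Fin (n ν + 1))) (q : ℕ → unitInterval) :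
    Prop where
  ratio : ∃ c : ℝ, c ≠ 0 ∧ Tendsto (fun ν => (m ν : ℝ) / (n ν : ℝ)) atTop (𝓝 c)
  moment_one : ∃ c : ℝ, c ≠ 0 ∧ Tendsto (fun ν => factorialMoment (π ν) 1) atTop (𝓝 c)
  moment_two : ∃ c : ℝ, c ≠ 0 ∧ Tendsto (fun ν => factorialMoment (π ν) 2) atTop (𝓝 c)
  moment_three : ∃ c : ℝ, c ≠ 0 ∧ Tendsto (fun ν => factorialMoment (π ν) 3) atTop (𝓝 c)
  link_prob : ∃ c : ℝ, c ≠ 0 ∧ Tendsto (fun ν => (q ν : ℝ)) atTop (𝓝 c)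

/-- `X = o_P(1)`: the random variables `X ν`, which may live on different probability spaces,
converge to zero in probability. -/
def IsLittleOP {Ω : ℕ → Type*} [∀ ν, MeasurableSpace (Ω ν)] (P : ∀ ν, Measure (Ω ν))
    (X : ∀ ν, Ω ν → ℝ) : Prop :=
  ∀ ε : ℝ, 0 < ε → Tendsto (fun ν => P ν {ω | ε < |X ν ω|}) atTop (𝓝 0)

/-- `N = (1 + o_P(1)) E N`, where the random variables `N ν` are integrable. -/
def EqOneAddLittleOPMean {Ω : ℕ → Type*} [∀ ν, MeasurableSpace (Ω ν)] (P : ∀ ν, Measure (Ω ν))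
    (N : ∀ ν, Ω ν → ℝ) : Prop :=
  (∀ ν, Integrable (N ν) (P ν)) ∧
    ∃ X : ∀ ν, Ω ν → ℝ, (∀ ν, Measurable (X ν)) ∧ IsLittleOP P X ∧
      ∀ ν, ∀ᵐ ω ∂P ν, N ν ω = (1 + X ν ω) * ∫ ω', N ν ω' ∂P ν

/-!
The sample space is a product of `m` independent identically distributed *layers*
`Z k = (V k, C k)`; a node set of size `r` lies in `V k` with probability
`p_r = (π)_r / (n)_r` (`communityPMF_real_superset`), which is of order `n ^ (-r)`, while `m` is of
order `n`. All counts are compared with their labelled versions, i.e. with the number of injections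
`φ : Fin r ↪ Fin n` into the observed set `S` that map links to links; by
`labelledCopyCount_eq_copyCount_mul` and `two_mul_ncard_edgeSet` this only introduces a constant
factor, to which the claim is insensitive.

Write `N` for a labelled count, `n₀ = |S|`, and `a = n₀ ^ r / n ^ (r - 1)` for the order of its mean
(`r = 2` for links, `r = 3` for two-stars and triangles). The growth assumptions on `n₀` say exactly
that `a → ∞`. The count is approximated by sums over layers:

* a link or a triangle is, up to a negligible error, realised inside a single layer, so that
  `N ≈ ∑ k, t (Z k)` with `t` the number of labelled copies inside one layer;
* for the two-star the copies whose two links belong to different layers are of the same order,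
  so that `N ≈ ∑ k, t (Z k) + ∑ k ≠ l, f (Z k) (Z l)`, with `f` given by `crossStarCount`.

The error is bounded in mean by `O(a / n)`, since an additional layer on an already covered
configuration costs a factor `m p_2 = O(n ^ (-1))` (`SparseBound.integral_offDiag_mul_sum_le`). The
summands of the first sum are independent, and `t ≤ (W)_r` for the number `W` of observed members of
the community; expanding `(W)_r ^ 2` in factorial moments of order at most `2 r`, which is where the
moments `(π)_4` and `(π)_6` enter, bounds its variance by `O(a)`. In the second sum only pairs of
summands that share a layer are correlated (`variance_sum_layer_pairs_le`), and its variance is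
`O(a)` as well. Altogether `𝔼 |N - 𝔼 N| = O(√a + a / n)` while `𝔼 N` is at least of order `a`, and
Markov's inequality gives the theorem.
-/

/-! ### The layers of the model -/

/-- A layer of the model: a community together with the matrix of its potential links. -/
abbrev Layer (n : ℕ) : Type := Finset (Fin n) × (Sym2 (Fin n) → Bool)

/-- The common law of the layers. -/
noncomputable def layerMeasure {n : ℕ} (π : PMF (Fin (n + 1))) (q : unitInterval) :
    Measure (Layer n) :=
  (communityPMF π).toMeasure.prod
    (Measure.pi fun _ : Sym2 (Fin n) => bernoulliMeasure true false q)

/-- The `k`-th layer of a point of the sample space. -/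
def layer {n m : ℕ} (k : Fin m) (ω : ModelSpace n m) : Layer n := (ω.1 k, ω.2 k)

section Layers

variable {n m : ℕ} (π : PMF (Fin (n + 1))) (q : unitInterval)

instance instIsProbabilityMeasureModelMeasure :
    IsProbabilityMeasure (modelMeasure n m π q) := by
  unfold modelMeasure; infer_instance

instance instIsProbabilityMeasureLayerMeasure :
    IsProbabilityMeasure (layerMeasure π q) := by
  unfold layerMeasure; infer_instance

/-- The sample space is the product of its layers. -/
theorem measurePreserving_layers :
    MeasurePreserving (fun (ω : ModelSpace n m) k => layer k ω) (modelMeasure n m π q)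
      (Measure.pi fun _ : Fin m => layerMeasure π q) :=
  (measurePreserving_arrowProdEquivProdArrow (Finset (Fin n)) (Sym2 (Fin n) → Bool) (Fin m)
    (fun _ => (communityPMF π).toMeasure)
    (fun _ => Measure.pi fun _ => bernoulliMeasure true false q)).symm

theorem measurable_layer (k : Fin m) : Measurable (layer k : ModelSpace n m → Layer n) :=
  Measurable.of_discrete

theorem measurePreserving_layer (k : Fin m) :
    MeasurePreserving (layer k) (modelMeasure n m π q) (layerMeasure π q) :=
  (measurePreserving_eval (fun _ : Fin m => layerMeasure π q) k).comp
    (measurePreserving_layers π q)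

theorem iIndepFun_layer :
    iIndepFun (fun k : Fin m => (layer k : ModelSpace n m → Layer n))
      (modelMeasure n m π q) := by
  rw [iIndepFun_iff_map_fun_eq_pi_map fun k => (measurable_layer k).aemeasurable]
  simp_rw [(measurePreserving_layer π q _).map_eq]
  exact (measurePreserving_layers π q).map_eq

theorem integral_layer (k : Fin m) (g : Layer n → ℝ) :
    ∫ ω, g (layer k ω) ∂modelMeasure n m π q = ∫ z, g z ∂layerMeasure π q := by
  rw [← (measurePreserving_layer π q k).map_eq,
    integral_map (measurable_layer k).aemeasurable
      (Measurable.of_discrete (f := g)).aestronglyMeasurable]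

theorem integral_layer_mul {k l : Fin m} (hkl : k ≠ l) (g h : Layer n → ℝ) :
    ∫ ω, g (layer k ω) * h (layer l ω) ∂modelMeasure n m π q
      = (∫ z, g z ∂layerMeasure π q) * ∫ z, h z ∂layerMeasure π q := by
  have hi := ((iIndepFun_layer (m := m) π q).indepFun hkl).comp
    (Measurable.of_discrete (f := g)) (Measurable.of_discrete (f := h))
  rw [← integral_layer π q k g, ← integral_layer π q l h]
  exact hi.integral_mul_eq_mul_integral Measurable.of_discrete.aestronglyMeasurable
    Measurable.of_discrete.aestronglyMeasurable

theorem integral_layer_mul_mul {k l j : Fin m} (hkl : k ≠ l) (hkj : k ≠ j) (hlj : l ≠ j)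
    (g h r : Layer n → ℝ) :
    ∫ ω, g (layer k ω) * h (layer l ω) * r (layer j ω) ∂modelMeasure n m π q
      = (∫ z, g z ∂layerMeasure π q) * (∫ z, h z ∂layerMeasure π q)
        * ∫ z, r z ∂layerMeasure π q := by
  have hi := ((iIndepFun_layer (m := m) π q).indepFun_prodMk measurable_layer k l j hkj hlj).comp
    (Measurable.of_discrete (f := fun z : Layer n × Layer n => g z.1 * h z.2))
    (Measurable.of_discrete (f := r))
  rw [← integral_layer_mul π q hkl g h, ← integral_layer π q j r]
  exact hi.integral_mul_eq_mul_integral Measurable.of_discrete.aestronglyMeasurable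
    Measurable.of_discrete.aestronglyMeasurable

end Layers

/-! ### Covering probabilities -/

/-- The probability that a community contains a given set of `r` nodes. -/
noncomputable def coverProb {n : ℕ} (π : PMF (Fin (n + 1))) (r : ℕ) : ℝ :=
  factorialMoment π r / (n.descFactorial r : ℝ)

theorem factorialMoment_nonneg {n : ℕ} (π : PMF (Fin (n + 1))) (r : ℕ) :
    0 ≤ factorialMoment π r :=
  Finset.sum_nonneg fun _ _ => by positivity

theorem coverProb_nonneg {n : ℕ} (π : PMF (Fin (n + 1))) (r : ℕ) : 0 ≤ coverProb π r :=
  div_nonneg (factorialMoment_nonneg π r) (Nat.cast_nonneg _)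

theorem card_filter_superset {n : ℕ} (A : Finset (Fin n)) {x : ℕ} (hx : A.card ≤ x) :
    (Finset.univ.filter fun V : Finset (Fin n) => A ⊆ V ∧ V.card = x).card
      = (n - A.card).choose (x - A.card) := by
  have : (Finset.powersetCard (x - A.card) Aᶜ).card = (n - A.card).choose (x - A.card) := by
    rw [Finset.card_powersetCard, Finset.card_compl, Fintype.card_fin]
  rw [← this]
  refine Finset.card_bij' (fun V _ => V \ A) (fun U _ => U ∪ A) ?_ ?_ ?_ ?_
  · intro V hV
    obtain ⟨hA, hc⟩ := (Finset.mem_filter.1 hV).2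
    rw [Finset.mem_powersetCard, Finset.card_sdiff_of_subset hA, hc]
    exact ⟨fun a ha => Finset.mem_compl.2 (Finset.mem_sdiff.1 ha).2, rfl⟩
  · intro U hU
    obtain ⟨hA, hc⟩ := Finset.mem_powersetCard.1 hU
    have hd : Disjoint U A := Finset.disjoint_left.2 fun a ha => Finset.mem_compl.1 (hA ha)
    refine Finset.mem_filter.2 ⟨Finset.mem_univ _, Finset.subset_union_right, ?_⟩
    rw [Finset.card_union_of_disjoint hd, hc]
    omega
  · intro V hV
    exact Finset.sdiff_union_of_subset (Finset.mem_filter.1 hV).2.1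
  · intro U hU
    obtain ⟨hA, hc⟩ := Finset.mem_powersetCard.1 hU
    have hd : Disjoint U A := Finset.disjoint_left.2 fun a ha => Finset.mem_compl.1 (hA ha)
    exact Finset.union_sdiff_cancel_right hd

theorem descFactorial_mul_choose {n x r : ℕ} (hx : r ≤ x) :
    (n - r).choose (x - r) * n.descFactorial r = x.descFactorial r * n.choose x := by
  rw [Nat.descFactorial_eq_factorial_mul_choose, Nat.descFactorial_eq_factorial_mul_choose]
  have := Nat.choose_mul (n := n) hx
  calc _ = r.factorial * (n.choose r * (n - r).choose (x - r)) := by ring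
    _ = r.factorial * (n.choose x * x.choose r) := by rw [this]
    _ = _ := by ring

theorem communityPMF_apply_toReal {n : ℕ} (π : PMF (Fin (n + 1))) (V : Finset (Fin n)) :
    (communityPMF π V).toReal = (π (communitySize V)).toReal / (n.choose V.card : ℝ) := by
  simp [communityPMF, ENNReal.toReal_div]

theorem communityPMF_real_superset {n : ℕ} (π : PMF (Fin (n + 1))) (A : Finset (Fin n)) :
    (communityPMF π).toMeasure.real {V | A ⊆ V} = coverProb π A.card := by
  classical
  have hcard : A.card ≤ n := by simpa using A.card_le_univ
  have h1 : (communityPMF π).toMeasure.real {V | A ⊆ V}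
      = ∑ V : Finset (Fin n), if A ⊆ V then (communityPMF π V).toReal else 0 := by
    rw [measureReal_def, PMF.toMeasure_apply_fintype, ENNReal.toReal_sum]
    · refine Finset.sum_congr rfl fun V _ => ?_
      by_cases h : A ⊆ V <;> simp [h]
    · intro V _
      by_cases h : A ⊆ V <;> simp [h, PMF.apply_ne_top]
  rw [h1, ← Finset.sum_fiberwise Finset.univ communitySize, coverProb, factorialMoment,
    Finset.sum_div]
  refine Finset.sum_congr rfl fun x _ => ?_
  have hxn : (x : ℕ) ≤ n := Nat.le_of_lt_succ x.isLt
  have h2 : ∀ V ∈ Finset.univ.filter fun V : Finset (Fin n) => communitySize V = x,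
      (if A ⊆ V then (communityPMF π V).toReal else 0)
        = if A ⊆ V then (π x).toReal / (n.choose (x : ℕ) : ℝ) else 0 := by
    intro V hV
    have hV' : communitySize V = x := by simpa using hV
    subst hV'
    rw [communityPMF_apply_toReal]
    rfl
  rw [Finset.sum_congr rfl h2, ← Finset.sum_filter, Finset.filter_filter, Finset.sum_const,
    nsmul_eq_mul]
  have h3 : (Finset.univ.filter fun V : Finset (Fin n) => communitySize V = x ∧ A ⊆ V)
      = Finset.univ.filter fun V : Finset (Fin n) => A ⊆ V ∧ V.card = x := by
    ext V
    simp [communitySize, Fin.ext_iff, and_comm]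
  rw [h3]
  have hc : (0 : ℝ) < n.choose (x : ℕ) := by exact_mod_cast Nat.choose_pos hxn
  have hd : (0 : ℝ) < n.descFactorial A.card := by
    exact_mod_cast Nat.descFactorial_pos.2 hcard
  rcases le_or_gt A.card (x : ℕ) with hx | hx
  · rw [card_filter_superset A hx]
    have := descFactorial_mul_choose (n := n) hx
    have h4 : (((n - A.card).choose (x - A.card) : ℕ) : ℝ) * (n.descFactorial A.card : ℝ)
        = ((x : ℕ).descFactorial A.card : ℝ) * (n.choose (x : ℕ) : ℝ) := by exact_mod_cast this
    field_simp
    linear_combination (π x).toReal * h4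
  · rw [Nat.descFactorial_eq_zero_iff_lt.2 hx, Finset.filter_eq_empty_iff.2]
    · simp
    · rintro V - ⟨h, h'⟩
      exact absurd (Finset.card_le_card h) (by omega)

/-- A community contains the node set `A` and its layer realises the pairs `B` with probability
`p_{|A|} q^{|B|}`. -/
theorem layerMeasure_real_cover {n : ℕ} (π : PMF (Fin (n + 1))) (q : unitInterval)
    (A : Finset (Fin n)) (B : Finset (Sym2 (Fin n))) :
    (layerMeasure π q).real {z | A ⊆ z.1 ∧ ∀ e ∈ B, z.2 e = true}
      = coverProb π A.card * (q : ℝ) ^ B.card := by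
  classical
  have h1 : {z : Layer n | A ⊆ z.1 ∧ ∀ e ∈ B, z.2 e = true}
      = {V | A ⊆ V} ×ˢ Set.univ.pi fun e => if e ∈ B then {true} else Set.univ := by
    ext z
    simp only [Set.mem_ofPred_eq, Set.mem_prod, Set.mem_pi, Set.mem_univ, true_implies]
    refine and_congr_right fun _ => forall_congr' fun e => ?_
    by_cases h : e ∈ B <;> simp [h]
  rw [h1, layerMeasure, measureReal_prod_prod, communityPMF_real_superset]
  congr 1
  rw [measureReal_def, Measure.pi_pi, ENNReal.toReal_prod]
  have h2 : ∀ e, ((bernoulliMeasure true false q) (if e ∈ B then {true} else Set.univ)).toReal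
      = if e ∈ B then (q : ℝ) else 1 := by
    intro e
    by_cases h : e ∈ B <;> simp [h]
  simp_rw [h2]
  rw [Finset.prod_ite_mem, Finset.univ_inter, Finset.prod_const]

/-- The indicator that a community contains the node set `A`. -/
def coverInd {n : ℕ} (A : Finset (Fin n)) (z : Layer n) : ℝ := if A ⊆ z.1 then 1 else 0

theorem coverInd_nonneg {n : ℕ} (A : Finset (Fin n)) (z : Layer n) : 0 ≤ coverInd A z := by
  unfold coverInd; split_ifs <;> norm_num

theorem coverInd_mul_coverInd {n : ℕ} (A B : Finset (Fin n)) (z : Layer n) :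
    coverInd A z * coverInd B z = coverInd (A ∪ B) z := by
  unfold coverInd
  by_cases h : A ⊆ z.1 <;> by_cases h' : B ⊆ z.1 <;> simp [h, h', Finset.union_subset_iff]

theorem coverInd_anti {n : ℕ} {A B : Finset (Fin n)} (h : A ⊆ B) (z : Layer n) :
    coverInd B z ≤ coverInd A z := by
  unfold coverInd
  by_cases h' : B ⊆ z.1
  · rw [if_pos h', if_pos (h.trans h')]
  · rw [if_neg h']; split_ifs <;> norm_num

theorem integral_coverInd {n : ℕ} (π : PMF (Fin (n + 1))) (q : unitInterval) (A : Finset (Fin n)) :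
    ∫ z, coverInd A z ∂layerMeasure π q = coverProb π A.card := by
  have h := layerMeasure_real_cover π q A ∅
  have h1 : (fun z : Layer n => coverInd A z)
      = {z : Layer n | A ⊆ z.1 ∧ ∀ e ∈ (∅ : Finset (Sym2 (Fin n))), z.2 e = true}.indicator 1 := by
    ext z
    simp [coverInd, Set.indicator_apply]
  rw [h1, integral_indicator_one (MeasurableSet.of_discrete), h]
  simp

/-! ### Labelled copies of a graph -/

section Counting

open SimpleGraph

variable {n r : ℕ}

/-- The injective maps from `r` labels to the nodes of `S`. -/
noncomputable def labellings (r : ℕ) (S : Finset (Fin n)) : Finset (Fin r ↪ Fin n) :=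
  Finset.univ.filter fun φ => ∀ a, φ a ∈ S

theorem mem_labellings {S : Finset (Fin n)} {φ : Fin r ↪ Fin n} :
    φ ∈ labellings r S ↔ ∀ a, φ a ∈ S := by
  simp [labellings]

theorem card_labellings (S : Finset (Fin n)) :
    (labellings r S).card = S.card.descFactorial r := by
  have h := Fintype.card_embedding_eq (α := Fin r) (β := S)
  rw [Fintype.card_coe, Fintype.card_fin] at h
  rw [← h, ← Finset.card_univ]
  refine Finset.card_bij'
    (fun φ hφ => ⟨fun a => ⟨φ a, mem_labellings.1 hφ a⟩, fun a b hab =>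
      φ.injective (Subtype.ext_iff.1 hab)⟩)
    (fun ψ _ => ψ.trans (Function.Embedding.subtype _)) ?_ ?_ ?_ ?_
  · intro φ hφ
    exact Finset.mem_univ _
  · intro ψ _
    exact mem_labellings.2 fun a => (ψ a).2
  · intro φ hφ
    rfl
  · intro ψ _
    rfl

open Classical in
/-- The number of labelled copies of `H` in `G` whose nodes lie in `S`. -/
noncomputable def labelledCount (S : Finset (Fin n)) (H : SimpleGraph (Fin r))
    (G : SimpleGraph (Fin n)) : ℕ :=
  ((labellings r S).filter fun φ => ∀ a b, H.Adj a b → G.Adj (φ a) (φ b)).card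

theorem labelledCopyCount_induce (S : Finset (Fin n)) (H : SimpleGraph (Fin r))
    (G : SimpleGraph (Fin n)) :
    (G.induce (S : Set (Fin n))).labelledCopyCount H = labelledCount S H G := by
  classical
  rw [labelledCopyCount, labelledCount]
  refine (@Finset.card_univ _ (_)).symm.trans (Finset.card_bij
    (fun f _ => f.toEmbedding.trans (Function.Embedding.subtype _)) ?_ ?_ ?_)
  · intro f _
    refine Finset.mem_filter.2 ⟨mem_labellings.2 fun a => (f a).2, fun a b hab => ?_⟩
    exact f.toHom.map_adj hab
  · intro f _ g _ hfg
    ext a : 1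
    exact Subtype.ext (DFunLike.congr_fun hfg a)
  · intro φ hφ
    obtain ⟨hS, hadj⟩ := Finset.mem_filter.1 hφ
    refine ⟨⟨⟨fun a => ⟨φ a, mem_labellings.1 hS a⟩, fun {a b} hab => hadj a b hab⟩,
      fun a b hab => φ.injective (Subtype.ext_iff.1 hab)⟩, @Finset.mem_univ _ (_) _, ?_⟩
    ext a : 1
    rfl

/-- The labelled copies of `H` with the same image are a torsor under the automorphisms of `H`. -/
theorem labelledCopyCount_eq_copyCount_mul {V W : Type*} [Fintype V] [Fintype W]
    (G : SimpleGraph V) (H : SimpleGraph W) :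
    G.labelledCopyCount H = G.copyCount H * Nat.card (H ≃g H) := by
  classical
  have hadj : ∀ (f : Copy H G) (a b : W), f.toSubgraph.Adj (f a) (f b) ↔ H.Adj a b := by
    intro f a b
    refine ⟨?_, fun h => ⟨a, b, h, rfl, rfl⟩⟩
    rintro ⟨a', b', h, ha, hb⟩
    rwa [← f.injective ha, ← f.injective hb]
  rw [copyCount_eq_card_image_copyToSubgraph, labelledCopyCount, ← Finset.card_univ,
    Finset.card_eq_sum_card_image (Copy.toSubgraph (A := H) (B := G)) Finset.univ]
  refine Finset.sum_const_nat fun G' hG' => ?_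
  obtain ⟨f, -, rfl⟩ := Finset.mem_image.1 hG'
  have : Finite (H ≃g H) :=
    Finite.of_injective (fun σ => (σ : W → W)) DFunLike.coe_injective
  have : Fintype (H ≃g H) := Fintype.ofFinite _
  rw [Nat.card_eq_fintype_card, ← Finset.card_univ]
  symm
  refine Finset.card_bij (fun σ _ => f.comp σ.toCopy) ?_ ?_ ?_
  · intro σ _
    refine Finset.mem_filter.2 ⟨Finset.mem_univ _, ?_⟩
    ext x y
    · simp only [Copy.toSubgraph, Subgraph.map_verts, Subgraph.verts_top, Set.image_univ,
        Set.mem_range]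
      refine ⟨fun ⟨a, ha⟩ => ⟨σ a, ha⟩, fun ⟨a, ha⟩ => ⟨σ.symm a, ?_⟩⟩
      rw [← ha]
      exact congrArg f (σ.apply_symm_apply a)
    · constructor
      · rintro ⟨a, b, h, rfl, rfl⟩
        exact ⟨σ a, σ b, σ.map_adj_iff.2 h, rfl, rfl⟩
      · rintro ⟨a, b, h, rfl, rfl⟩
        refine ⟨σ.symm a, σ.symm b, σ.symm.map_adj_iff.2 h, ?_, ?_⟩
        · exact congrArg f (σ.apply_symm_apply a)
        · exact congrArg f (σ.apply_symm_apply b)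
  · intro σ _ τ _ h
    ext a
    exact f.injective (DFunLike.congr_fun h a)
  · intro g hg
    have hgf : g.toSubgraph = f.toSubgraph := (Finset.mem_filter.1 hg).2
    have h1 : ∀ a, ∃ b, f b = g a := by
      intro a
      have : g a ∈ f.toSubgraph.verts := hgf ▸ ⟨a, Set.mem_univ _, rfl⟩
      obtain ⟨b, -, hb⟩ := this
      exact ⟨b, hb⟩
    choose σ hσ using h1
    have hinj : Function.Injective σ := fun a b hab =>
      g.injective (by simpa [← hσ] using congrArg f hab)
    refine ⟨⟨Equiv.ofBijective σ (Finite.injective_iff_bijective.1 hinj), fun {a b} => ?_⟩,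
      Finset.mem_univ _, ?_⟩
    · rw [Equiv.ofBijective_apply, Equiv.ofBijective_apply, ← hadj f, hσ, hσ, ← hgf, hadj g]
    · ext a
      exact hσ a

theorem two_mul_ncard_edgeSet {V : Type*} [Fintype V] (G : SimpleGraph V) :
    2 * G.edgeSet.ncard = G.labelledCopyCount (⊤ : SimpleGraph (Fin 2)) := by
  classical
  rw [← coe_edgeFinset, Set.ncard_coe_finset, ← dart_card_eq_twice_card_edges, labelledCopyCount]
  symm
  refine (@Finset.card_univ _ (_)).symm.trans ((Finset.card_bij
    (fun f _ => ⟨(f 0, f 1), f.toHom.map_adj (by simp)⟩) ?_ ?_ ?_).trans Finset.card_univ)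
  · intro f _
    exact Finset.mem_univ _
  · intro f _ g _ h
    have h' := congrArg Dart.toProd h
    ext a
    fin_cases a
    · exact congrArg Prod.fst h'
    · exact congrArg Prod.snd h'
  · rintro ⟨⟨x, y⟩, hxy⟩ -
    have hne : x ≠ y := G.ne_of_adj hxy
    refine ⟨⟨⟨![x, y], fun {a b} hab => ?_⟩, fun a b hab => ?_⟩, @Finset.mem_univ _ (_) _, rfl⟩
    · fin_cases a <;> fin_cases b <;> simp_all [hxy.symm]
    · fin_cases a <;> fin_cases b <;> simp_all [hne.symm]

end Counting

/-! ### Mean absolute deviation -/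

section Deviation

variable {Ω : Type*} [MeasurableSpace Ω] [Finite Ω] [DiscreteMeasurableSpace Ω]
  (P : Measure Ω) [IsProbabilityMeasure P]

/-- The mean absolute deviation `𝔼 |X - 𝔼 X|`. -/
noncomputable def meanAbsDev (X : Ω → ℝ) : ℝ := ∫ ω, |X ω - ∫ ω', X ω' ∂P| ∂P

theorem meanAbsDev_add_le (X Y : Ω → ℝ) :
    meanAbsDev P (fun ω => X ω + Y ω) ≤ meanAbsDev P X + meanAbsDev P Y := by
  unfold meanAbsDev
  rw [← integral_add .of_finite .of_finite, integral_add (f := X) .of_finite .of_finite]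
  refine integral_mono .of_finite .of_finite fun ω => ?_
  simpa only [add_sub_add_comm] using
    abs_add_le (X ω - ∫ ω', X ω' ∂P) (Y ω - ∫ ω', Y ω' ∂P)

theorem meanAbsDev_le_two_mul (X : Ω → ℝ) : meanAbsDev P X ≤ 2 * ∫ ω, |X ω| ∂P := by
  have h : |∫ ω, X ω ∂P| ≤ ∫ ω, |X ω| ∂P := abs_integral_le_integral_abs
  calc meanAbsDev P X ≤ ∫ ω, (|X ω| + |∫ ω', X ω' ∂P|) ∂P :=
        integral_mono .of_finite .of_finite fun ω => abs_sub _ _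
    _ = (∫ ω, |X ω| ∂P) + |∫ ω', X ω' ∂P| := by
        rw [integral_add .of_finite .of_finite]; simp
    _ ≤ _ := by linarith

theorem meanAbsDev_le_sqrt_variance (X : Ω → ℝ) : meanAbsDev P X ≤ √(Var[X; P]) := by
  refine Real.le_sqrt_of_sq_le ?_
  have h := variance_eq_sub (μ := P) (X := fun ω => |X ω - ∫ ω', X ω' ∂P|) .of_discrete
  have h0 := variance_nonneg (fun ω => |X ω - ∫ ω', X ω' ∂P|) P
  rw [h] at h0
  rw [variance_eq_integral Measurable.of_discrete.aemeasurable, meanAbsDev]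
  simp only [Pi.pow_apply, sq_abs] at h0
  linarith

/-- A variable that is approximated in mean by a sum of two variables inherits their
concentration. -/
theorem meanAbsDev_le_of_approx {X Y Z R : Ω → ℝ} (h : ∀ ω, |X ω - (Y ω + Z ω)| ≤ R ω) :
    meanAbsDev P X ≤ √(Var[Y; P]) + √(Var[Z; P]) + 2 * ∫ ω, R ω ∂P := by
  have h1 : meanAbsDev P X ≤ meanAbsDev P (fun ω => Y ω + Z ω)
      + meanAbsDev P (fun ω => X ω - (Y ω + Z ω)) := by
    refine le_trans (le_of_eq ?_) (meanAbsDev_add_le P _ _)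
    congr 1
    ext ω
    ring
  have h2 := meanAbsDev_add_le P Y Z
  have h3 := meanAbsDev_le_sqrt_variance P Y
  have h4 := meanAbsDev_le_sqrt_variance P Z
  have h5 := meanAbsDev_le_two_mul P (fun ω => X ω - (Y ω + Z ω))
  have h6 : ∫ ω, |X ω - (Y ω + Z ω)| ∂P ≤ ∫ ω, R ω ∂P :=
    integral_mono .of_finite .of_finite h
  linarith

end Deviation

/-! ### Variances of sums over layers -/

section LayerVariance

variable {n m : ℕ} (π : PMF (Fin (n + 1))) (q : unitInterval)

theorem variance_sum_layer_le (g : Layer n → ℝ) :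
    Var[fun ω => ∑ k : Fin m, g (layer k ω); modelMeasure n m π q]
      ≤ m * ∫ z, g z ^ 2 ∂layerMeasure π q := by
  have h := IndepFun.variance_sum (μ := modelMeasure n m π q) (s := Finset.univ)
    (X := fun (k : Fin m) ω => g (layer k ω)) (fun _ _ => .of_discrete)
    (fun k _ l _ hkl => ((iIndepFun_layer π q).indepFun hkl).comp
      (Measurable.of_discrete (f := g)) (Measurable.of_discrete (f := g)))
  have h1 : (∑ k : Fin m, fun ω : ModelSpace n m => g (layer k ω))
      = fun ω => ∑ k : Fin m, g (layer k ω) := by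
    ext ω; simp
  rw [h1] at h
  rw [h]
  calc _ ≤ ∑ _k : Fin m, ∫ z, g z ^ 2 ∂layerMeasure π q := by
        refine Finset.sum_le_sum fun k _ => ?_
        refine (variance_le_expectation_sq Measurable.of_discrete.aestronglyMeasurable).trans ?_
        exact (integral_layer π q k fun z => g z ^ 2).le
    _ = _ := by simp

/-- A sum over pairs of distinct layers: only pairs of pairs that share a layer are correlated. -/
theorem variance_sum_layer_pairs_le (f : Layer n → Layer n → ℝ) (hf : ∀ z w, 0 ≤ f z w)
    (hsymm : ∀ z w, f z w = f w z) {A B : ℝ} (hA0 : 0 ≤ A) (hB0 : 0 ≤ B)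
    (hA : ∀ k l : Fin m, k ≠ l →
      ∫ ω, f (layer k ω) (layer l ω) ^ 2 ∂modelMeasure n m π q ≤ A)
    (hB : ∀ k l j : Fin m, k ≠ l → k ≠ j → l ≠ j →
      ∫ ω, f (layer k ω) (layer l ω) * f (layer k ω) (layer j ω) ∂modelMeasure n m π q ≤ B) :
    Var[fun ω => ∑ p ∈ (Finset.univ : Finset (Fin m)).offDiag, f (layer p.1 ω) (layer p.2 ω);
      modelMeasure n m π q] ≤ 4 * ((m : ℝ) ^ 2 * A + (m : ℝ) ^ 3 * B) := by
  have hV := variance_fun_sum' (μ := modelMeasure n m π q)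
    (s := (Finset.univ : Finset (Fin m)).offDiag)
    (X := fun (p : Fin m × Fin m) ω => f (layer p.1 ω) (layer p.2 ω)) (fun _ _ => .of_discrete)
  rw [hV]
  set b : Fin m → Fin m → ℝ := fun x y => (if x = y then A else 0) + B with hb
  have hb0 : ∀ x y, 0 ≤ b x y := fun x y => by
    simp only [hb]; split_ifs <;> linarith
  set c : Fin m × Fin m → Fin m × Fin m → ℝ := fun p p' =>
    (if p.1 = p'.1 then b p.2 p'.2 else 0) + (if p.1 = p'.2 then b p.2 p'.1 else 0)
      + (if p.2 = p'.1 then b p.1 p'.2 else 0) + (if p.2 = p'.2 then b p.1 p'.1 else 0) with hc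
  have hite : ∀ (Q : Prop) [Decidable Q] (x y : Fin m), 0 ≤ if Q then b x y else 0 := by
    intro Q _ x y
    split_ifs
    · exact hb0 x y
    · exact le_rfl
  have hc0 : ∀ p p', 0 ≤ c p p' := fun p p' => by
    have := hite (p.1 = p'.1) p.2 p'.2
    have := hite (p.1 = p'.2) p.2 p'.1
    have := hite (p.2 = p'.1) p.1 p'.2
    have := hite (p.2 = p'.2) p.1 p'.1
    simp only [hc]; positivity
  have hshare : ∀ k l j : Fin m, k ≠ l → k ≠ j →
      ∫ ω, f (layer k ω) (layer l ω) * f (layer k ω) (layer j ω) ∂modelMeasure n m π q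
        ≤ b l j := by
    intro k l j hkl hkj
    by_cases hlj : l = j
    · subst hlj
      have := hA k l hkl
      simp only [sq] at this
      simp only [hb, if_true]
      linarith
    · have := hB k l j hkl hkj hlj
      simp only [hb, if_neg hlj]
      linarith
  have hcov : ∀ p ∈ (Finset.univ : Finset (Fin m)).offDiag,
      ∀ p' ∈ (Finset.univ : Finset (Fin m)).offDiag,
      cov[fun ω => f (layer p.1 ω) (layer p.2 ω), fun ω => f (layer p'.1 ω) (layer p'.2 ω);
        modelMeasure n m π q] ≤ c p p' := by
    rintro ⟨k, l⟩ hp ⟨k', l'⟩ hp'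
    have hkl : k ≠ l := (Finset.mem_offDiag.1 hp).2.2
    have hkl' : k' ≠ l' := (Finset.mem_offDiag.1 hp').2.2
    have hle : cov[fun ω => f (layer k ω) (layer l ω), fun ω => f (layer k' ω) (layer l' ω);
        modelMeasure n m π q]
        ≤ ∫ ω, f (layer k ω) (layer l ω) * f (layer k' ω) (layer l' ω) ∂modelMeasure n m π q := by
      rw [covariance_eq_sub .of_discrete .of_discrete]
      have h1 : 0 ≤ ∫ ω, f (layer k ω) (layer l ω) ∂modelMeasure n m π q :=
        integral_nonneg fun _ => hf _ _
      have h2 : 0 ≤ ∫ ω, f (layer k' ω) (layer l' ω) ∂modelMeasure n m π q :=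
        integral_nonneg fun _ => hf _ _
      have := mul_nonneg h1 h2
      simp only [Pi.mul_apply]
      linarith
    have a1 := hite (k = k') l l'
    have a2 := hite (k = l') l k'
    have a3 := hite (l = k') k l'
    have a4 := hite (l = l') k k'
    simp only [hc]
    by_cases e1 : k = k'
    · subst e1
      have := hshare k l l' hkl hkl'
      rw [if_pos rfl]
      linarith
    by_cases e2 : k = l'
    · subst e2
      have := hshare k l k' hkl hkl'.symm
      simp only [hsymm (layer k _) (layer k' _)] at this
      rw [if_pos rfl]
      linarith
    by_cases e3 : l = k'
    · subst e3
      have := hshare l k l' hkl.symm hkl'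
      simp only [hsymm (layer l _) (layer k _)] at this
      rw [if_pos rfl]
      linarith
    by_cases e4 : l = l'
    · subst e4
      have := hshare l k k' hkl.symm hkl'.symm
      simp only [hsymm (layer l _) (layer k _), hsymm (layer l _) (layer k' _)] at this
      rw [if_pos rfl]
      linarith
    have hi := ((iIndepFun_layer (m := m) π q).indepFun_prodMk_prodMk measurable_layer
      k l k' l' e1 e2 e3 e4).comp
      (Measurable.of_discrete (f := fun z : Layer n × Layer n => f z.1 z.2))
      (Measurable.of_discrete (f := fun z : Layer n × Layer n => f z.1 z.2))
    have h0 := hi.covariance_eq_zero .of_discrete .of_discrete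
    refine le_of_eq_of_le h0 ?_
    linarith
  calc _ ≤ ∑ p ∈ (Finset.univ : Finset (Fin m)).offDiag,
        ∑ p' ∈ (Finset.univ : Finset (Fin m)).offDiag, c p p' :=
        Finset.sum_le_sum fun p hp => Finset.sum_le_sum fun p' hp' => hcov p hp p' hp'
    _ ≤ ∑ p : Fin m × Fin m, ∑ p' : Fin m × Fin m, c p p' := by
        refine (Finset.sum_le_sum fun p _ => Finset.sum_le_univ_sum_of_nonneg (hc0 p)).trans ?_
        exact Finset.sum_le_univ_sum_of_nonneg fun p => Finset.sum_nonneg fun p' _ => hc0 p p'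
    _ = _ := by
        simp [hc, hb, Fintype.sum_prod_type, Finset.sum_add_distrib]
        ring

end LayerVariance

/-! ### Moments of the number of observed community members -/

section Moments

variable {n : ℕ} (π : PMF (Fin (n + 1))) (q : unitInterval) (S : Finset (Fin n))

/-- The number of observed nodes in a community. -/
def observedSize (z : Layer n) : ℕ := (S ∩ z.1).card

theorem descFactorial_observedSize (r : ℕ) (z : Layer n) :
    ((observedSize S z).descFactorial r : ℝ)
      = r.factorial * ∑ A ∈ Finset.powersetCard r S, coverInd A z := by
  have h : ∑ A ∈ Finset.powersetCard r S, coverInd A z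
      = ((Finset.powersetCard r (S ∩ z.1)).card : ℝ) := by
    have h1 : (Finset.powersetCard r S).filter (fun A => A ⊆ z.1)
        = Finset.powersetCard r (S ∩ z.1) := by
      ext A
      simp only [Finset.mem_filter, Finset.mem_powersetCard, Finset.subset_inter_iff]
      tauto
    simp only [coverInd]
    rw [← Finset.sum_filter, h1]
    simp
  rw [h, Finset.card_powersetCard, Nat.descFactorial_eq_factorial_mul_choose, observedSize]
  push_cast
  ring

theorem integral_descFactorial_observedSize (r : ℕ) :
    ∫ z, ((observedSize S z).descFactorial r : ℝ) ∂layerMeasure π q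
      = S.card.descFactorial r * coverProb π r := by
  simp_rw [descFactorial_observedSize]
  rw [integral_const_mul, integral_finsetSum _ fun _ _ => .of_finite]
  have h : ∀ A ∈ Finset.powersetCard r S, ∫ z, coverInd A z ∂layerMeasure π q = coverProb π r := by
    intro A hA
    rw [integral_coverInd, (Finset.mem_powersetCard.1 hA).2]
  rw [Finset.sum_congr rfl h, Finset.sum_const, Finset.card_powersetCard,
    Nat.descFactorial_eq_factorial_mul_choose, nsmul_eq_mul]
  push_cast
  ring

theorem descFactorial_two_sq (w : ℕ) : w.descFactorial 2 ^ 2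
    = w.descFactorial 4 + 4 * w.descFactorial 3 + 2 * w.descFactorial 2 := by
  rcases w with _ | _ | _ | _ | w
  · decide
  · decide
  · decide
  · decide
  · simp only [Nat.succ_descFactorial_succ, Nat.descFactorial_zero]
    ring

theorem descFactorial_three_sq (w : ℕ) : w.descFactorial 3 ^ 2
    = w.descFactorial 6 + 9 * w.descFactorial 5 + 18 * w.descFactorial 4
      + 6 * w.descFactorial 3 := by
  rcases w with _ | _ | _ | _ | _ | _ | w
  · decide
  · decide
  · decide
  · decide
  · decide
  · decide
  · simp only [Nat.succ_descFactorial_succ, Nat.descFactorial_zero]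
    ring

/-- The quantitative form of the balanced sparse regime: up to the constant `K`, there are at
most `n` layers and a given set of `r ≤ R` nodes is covered with probability at most `n ^ (-r)`. -/
structure SparseBound (m : ℕ) (K : ℝ) (R : ℕ) : Prop where
  pos : 0 < n
  one_le : 1 ≤ K
  layers : (m : ℝ) ≤ K * n
  cover : ∀ r ≤ R, coverProb π r ≤ K / (n : ℝ) ^ r

variable {π S} {m R : ℕ} {K : ℝ}

theorem SparseBound.integral_descFactorial_le (h : SparseBound π m K R) {r : ℕ} (hr : r ≤ R) :
    ∫ z, ((observedSize S z).descFactorial r : ℝ) ∂layerMeasure π q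
      ≤ K * ((S.card : ℝ) / n) ^ r := by
  rw [integral_descFactorial_observedSize]
  have h1 : ((S.card.descFactorial r : ℕ) : ℝ) ≤ (S.card : ℝ) ^ r := by
    exact_mod_cast Nat.descFactorial_le_pow _ _
  calc _ ≤ (S.card : ℝ) ^ r * (K / (n : ℝ) ^ r) :=
        mul_le_mul h1 (h.cover r hr) (coverProb_nonneg π r) (by positivity)
    _ = _ := by rw [div_pow]; ring

theorem card_div_le_one : (S.card : ℝ) / n ≤ 1 := by
  have : S.card ≤ n := by simpa using S.card_le_univ
  exact div_le_one_of_le₀ (by exact_mod_cast this) (by positivity)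

theorem SparseBound.integral_descFactorial_le' (h : SparseBound π m K R) {r s : ℕ} (hr : r ≤ R)
    (hs : s ≤ r) :
    ∫ z, ((observedSize S z).descFactorial r : ℝ) ∂layerMeasure π q
      ≤ K * ((S.card : ℝ) / n) ^ s := by
  have hK := h.one_le
  exact (h.integral_descFactorial_le q hr).trans
    (mul_le_mul_of_nonneg_left (pow_le_pow_of_le_one (by positivity) card_div_le_one hs)
      (by linarith))

theorem SparseBound.integral_two_sq_le (h : SparseBound π m K 4) :
    ∫ z, ((observedSize S z).descFactorial 2 : ℝ) ^ 2 ∂layerMeasure π q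
      ≤ 7 * K * ((S.card : ℝ) / n) ^ 2 := by
  have e : ∀ z : Layer n, ((observedSize S z).descFactorial 2 : ℝ) ^ 2
      = (observedSize S z).descFactorial 4 + 4 * (observedSize S z).descFactorial 3
        + 2 * (observedSize S z).descFactorial 2 := fun z => by
    exact_mod_cast descFactorial_two_sq _
  simp_rw [e]
  rw [integral_add .of_finite .of_finite, integral_add .of_finite .of_finite,
    integral_const_mul, integral_const_mul]
  have h4 := h.integral_descFactorial_le' (S := S) q (r := 4) (s := 2) (by norm_num) (by norm_num)
  have h3 := h.integral_descFactorial_le' (S := S) q (r := 3) (s := 2) (by norm_num) (by norm_num)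
  have h2 := h.integral_descFactorial_le' (S := S) q (r := 2) (s := 2) (by norm_num) (by norm_num)
  linarith

theorem SparseBound.integral_three_sq_le (h : SparseBound π m K 6) :
    ∫ z, ((observedSize S z).descFactorial 3 : ℝ) ^ 2 ∂layerMeasure π q
      ≤ 34 * K * ((S.card : ℝ) / n) ^ 3 := by
  have e : ∀ z : Layer n, ((observedSize S z).descFactorial 3 : ℝ) ^ 2
      = (observedSize S z).descFactorial 6 + 9 * (observedSize S z).descFactorial 5
        + 18 * (observedSize S z).descFactorial 4 + 6 * (observedSize S z).descFactorial 3 :=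
    fun z => by exact_mod_cast descFactorial_three_sq _
  simp_rw [e]
  rw [integral_add .of_finite .of_finite, integral_add .of_finite .of_finite,
    integral_add .of_finite .of_finite, integral_const_mul, integral_const_mul, integral_const_mul]
  have h6 := h.integral_descFactorial_le' (S := S) q (r := 6) (s := 3) (by norm_num) (by norm_num)
  have h5 := h.integral_descFactorial_le' (S := S) q (r := 5) (s := 3) (by norm_num) (by norm_num)
  have h4 := h.integral_descFactorial_le' (S := S) q (r := 4) (s := 3) (by norm_num) (by norm_num)
  have h3 := h.integral_descFactorial_le' (S := S) q (r := 3) (s := 3) (by norm_num) (by norm_num)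
  linarith

end Moments

/-! ### Labelled copies inside one layer -/

section LayerCopies

variable {n m r : ℕ}

/-- The graph of the links realised in one layer. -/
def layerGraph (z : Layer n) : SimpleGraph (Fin n) where
  Adj i j := i ≠ j ∧ i ∈ z.1 ∧ j ∈ z.1 ∧ z.2 s(i, j) = true
  symm := ⟨by
    rintro i j ⟨hij, hi, hj, hC⟩
    exact ⟨hij.symm, hj, hi, by rwa [Sym2.eq_swap]⟩⟩
  loopless := ⟨fun _ h => h.1 rfl⟩

theorem modelGraph_adj_iff (ω : ModelSpace n m) (i j : Fin n) :
    (modelGraph ω).Adj i j ↔ ∃ k, (layerGraph (layer k ω)).Adj i j :=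
  ⟨fun ⟨h, k, hk⟩ => ⟨k, h, hk⟩, fun ⟨k, h, hk⟩ => ⟨h, k, hk⟩⟩

open Classical in
/-- The entry of the adjacency matrix of `G` at `i`, `j`. -/
noncomputable def adjInd (G : SimpleGraph (Fin n)) (i j : Fin n) : ℝ := if G.Adj i j then 1 else 0

theorem adjInd_eq_zero_or_one (G : SimpleGraph (Fin n)) (i j : Fin n) :
    adjInd G i j = 0 ∨ adjInd G i j = 1 := by
  unfold adjInd; split_ifs <;> simp

theorem adjInd_nonneg (G : SimpleGraph (Fin n)) (i j : Fin n) : 0 ≤ adjInd G i j := by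
  rcases adjInd_eq_zero_or_one G i j with h | h <;> simp [h]

theorem adjInd_layer_le_coverInd (z : Layer n) (i j : Fin n) :
    adjInd (layerGraph z) i j ≤ coverInd {i, j} z := by
  unfold adjInd
  split_ifs with h
  · have : ({i, j} : Finset (Fin n)) ⊆ z.1 := by
      simp [Finset.insert_subset_iff, h.2.1, h.2.2.1]
    simp [coverInd, this]
  · exact coverInd_nonneg _ z

theorem adjInd_layer_le_adjInd_model (ω : ModelSpace n m) (k : Fin m) (i j : Fin n) :
    adjInd (layerGraph (layer k ω)) i j ≤ adjInd (modelGraph ω) i j := by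
  by_cases h : (layerGraph (layer k ω)).Adj i j
  · have h' : (modelGraph ω).Adj i j := (modelGraph_adj_iff ω i j).2 ⟨k, h⟩
    simp [adjInd, h, h']
  · simp only [adjInd, if_neg h]
    split_ifs <;> norm_num

theorem adjInd_model_le_sum (ω : ModelSpace n m) (i j : Fin n) :
    adjInd (modelGraph ω) i j ≤ ∑ k : Fin m, adjInd (layerGraph (layer k ω)) i j := by
  by_cases h : (modelGraph ω).Adj i j
  · obtain ⟨k, hk⟩ := (modelGraph_adj_iff ω i j).1 h
    have h1 : adjInd (modelGraph ω) i j = adjInd (layerGraph (layer k ω)) i j := by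
      simp [adjInd, h, hk]
    rw [h1]
    exact Finset.single_le_sum (f := fun k => adjInd (layerGraph (layer k ω)) i j)
      (fun _ _ => adjInd_nonneg _ _ _) (Finset.mem_univ k)
  · simp only [adjInd, if_neg h]
    exact Finset.sum_nonneg fun k _ => adjInd_nonneg (layerGraph (layer k ω)) i j

theorem labelledCount_top_two (S : Finset (Fin n)) (G : SimpleGraph (Fin n)) :
    (labelledCount S (⊤ : SimpleGraph (Fin 2)) G : ℝ)
      = ∑ φ ∈ labellings 2 S, adjInd G (φ 0) (φ 1) := by
  classical
  rw [labelledCount, Finset.card_filter, Nat.cast_sum]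
  refine Finset.sum_congr rfl fun φ _ => ?_
  have h : (∀ a b, (⊤ : SimpleGraph (Fin 2)).Adj a b → G.Adj (φ a) (φ b))
      ↔ G.Adj (φ 0) (φ 1) := by
    refine ⟨fun h => h 0 1 (by simp), fun h a b hab => ?_⟩
    fin_cases a <;> fin_cases b <;> first | exact absurd rfl hab | exact h | exact h.symm
  simp only [h, adjInd]
  split_ifs <;> simp

theorem labelledCount_star (S : Finset (Fin n)) (G : SimpleGraph (Fin n)) :
    (labelledCount S (SimpleGraph.starGraph (0 : Fin 3)) G : ℝ)
      = ∑ φ ∈ labellings 3 S, adjInd G (φ 0) (φ 1) * adjInd G (φ 0) (φ 2) := by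
  classical
  rw [labelledCount, Finset.card_filter, Nat.cast_sum]
  refine Finset.sum_congr rfl fun φ _ => ?_
  have h : (∀ a b, (SimpleGraph.starGraph (0 : Fin 3)).Adj a b → G.Adj (φ a) (φ b))
      ↔ G.Adj (φ 0) (φ 1) ∧ G.Adj (φ 0) (φ 2) := by
    refine ⟨fun h => ⟨h 0 1 (by simp), h 0 2 (by simp)⟩, fun h a b hab => ?_⟩
    rw [SimpleGraph.starGraph_adj] at hab
    fin_cases a <;> fin_cases b <;>
      first | exact h.1 | exact h.2 | exact h.1.symm | exact h.2.symm | simp at hab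
  simp only [h, adjInd]
  by_cases h1 : G.Adj (φ 0) (φ 1) <;> by_cases h2 : G.Adj (φ 0) (φ 2) <;> simp [h1, h2]

theorem labelledCount_top_three (S : Finset (Fin n)) (G : SimpleGraph (Fin n)) :
    (labelledCount S (⊤ : SimpleGraph (Fin 3)) G : ℝ)
      = ∑ φ ∈ labellings 3 S,
        adjInd G (φ 0) (φ 1) * adjInd G (φ 1) (φ 2) * adjInd G (φ 0) (φ 2) := by
  classical
  rw [labelledCount, Finset.card_filter, Nat.cast_sum]
  refine Finset.sum_congr rfl fun φ _ => ?_
  have h : (∀ a b, (⊤ : SimpleGraph (Fin 3)).Adj a b → G.Adj (φ a) (φ b))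
      ↔ G.Adj (φ 0) (φ 1) ∧ G.Adj (φ 1) (φ 2) ∧ G.Adj (φ 0) (φ 2) := by
    refine ⟨fun h => ⟨h 0 1 (by simp), h 1 2 (by simp), h 0 2 (by simp)⟩, fun h a b hab => ?_⟩
    fin_cases a <;> fin_cases b <;> first
      | exact absurd rfl hab | exact h.1 | exact h.2.1 | exact h.2.2
      | exact h.1.symm | exact h.2.1.symm | exact h.2.2.symm
  simp only [h, adjInd]
  by_cases h1 : G.Adj (φ 0) (φ 1) <;> by_cases h2 : G.Adj (φ 1) (φ 2) <;>
    by_cases h3 : G.Adj (φ 0) (φ 2) <;> simp [h1, h2, h3]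

variable (S : Finset (Fin n)) {H : SimpleGraph (Fin r)}

/-- If `H` has no isolated node, all nodes of a copy inside a layer belong to the community. -/
theorem labelledCount_layer_le (hH : ∀ a, ∃ b, H.Adj a b) (z : Layer n) :
    labelledCount S H (layerGraph z) ≤ (observedSize S z).descFactorial r := by
  classical
  rw [observedSize, ← card_labellings, labelledCount]
  refine Finset.card_le_card fun φ hφ => ?_
  obtain ⟨hS, hadj⟩ := Finset.mem_filter.1 hφ
  refine mem_labellings.2 fun a => ?_
  obtain ⟨b, hb⟩ := hH a
  exact Finset.mem_inter.2 ⟨mem_labellings.1 hS a, (hadj a b hb).2.1⟩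

theorem integral_labelledCount_layer (π : PMF (Fin (n + 1))) (q : unitInterval)
    (hH : ∀ a, ∃ b, H.Adj a b) [Fintype H.edgeSet] :
    ∫ z, (labelledCount S H (layerGraph z) : ℝ) ∂layerMeasure π q
      = S.card.descFactorial r * (coverProb π r * (q : ℝ) ^ H.edgeFinset.card) := by
  classical
  have h : ∀ φ : Fin r ↪ Fin n,
      ∫ z, (if ∀ a b, H.Adj a b → (layerGraph z).Adj (φ a) (φ b) then (1 : ℝ) else 0)
        ∂layerMeasure π q = coverProb π r * (q : ℝ) ^ H.edgeFinset.card := by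
    intro φ
    have h1 := layerMeasure_real_cover π q (Finset.univ.map φ)
      (H.edgeFinset.map φ.sym2Map)
    rw [Finset.card_map, Finset.card_map, Finset.card_univ, Fintype.card_fin] at h1
    rw [← h1, ← integral_indicator_one MeasurableSet.of_discrete]
    refine integral_congr_ae (ae_of_all _ fun z => ?_)
    have h2 : (∀ a b, H.Adj a b → (layerGraph z).Adj (φ a) (φ b))
        ↔ Finset.univ.map φ ⊆ z.1 ∧ ∀ e ∈ H.edgeFinset.map φ.sym2Map, z.2 e = true := by
      constructor
      · intro h
        refine ⟨fun x hx => ?_, fun e he => ?_⟩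
        · obtain ⟨a, -, rfl⟩ := Finset.mem_map.1 hx
          obtain ⟨b, hb⟩ := hH a
          exact (h a b hb).2.1
        · obtain ⟨e', he', rfl⟩ := Finset.mem_map.1 he
          induction e' with
          | _ a b =>
            rw [SimpleGraph.mem_edgeFinset, SimpleGraph.mem_edgeSet] at he'
            exact (h a b he').2.2.2
      · rintro ⟨hV, hC⟩ a b hab
        refine ⟨fun e => hab.ne (φ.injective e), hV (Finset.mem_map_of_mem _ (Finset.mem_univ _)),
          hV (Finset.mem_map_of_mem _ (Finset.mem_univ _)), hC _ ?_⟩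
        exact Finset.mem_map.2 ⟨s(a, b), by simpa using hab, rfl⟩
    simp only [h2, Set.indicator_apply, Set.mem_ofPred_eq, Pi.one_apply]
  have h3 : ∀ z : Layer n, (labelledCount S H (layerGraph z) : ℝ)
      = ∑ φ ∈ labellings r S,
        if ∀ a b, H.Adj a b → (layerGraph z).Adj (φ a) (φ b) then (1 : ℝ) else 0 := by
    intro z
    rw [labelledCount, Finset.card_filter, Nat.cast_sum]
    refine Finset.sum_congr rfl fun φ _ => ?_
    split_ifs <;> simp
  simp_rw [h3]
  rw [integral_finsetSum _ fun _ _ => .of_finite, Finset.sum_congr rfl fun φ _ => h φ,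
    Finset.sum_const, card_labellings, nsmul_eq_mul]

variable {S} {π : PMF (Fin (n + 1))} {K : ℝ} (q : unitInterval)

theorem variance_labelledCount_layers_le (hH : ∀ a, ∃ b, H.Adj a b) :
    Var[fun ω => ∑ k : Fin m, (labelledCount S H (layerGraph (layer k ω)) : ℝ);
      modelMeasure n m π q]
      ≤ m * ∫ z, ((observedSize S z).descFactorial r : ℝ) ^ 2 ∂layerMeasure π q := by
  refine (variance_sum_layer_le π q fun z => (labelledCount S H (layerGraph z) : ℝ)).trans ?_
  refine mul_le_mul_of_nonneg_left ?_ (Nat.cast_nonneg m)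
  refine integral_mono .of_finite .of_finite fun z => ?_
  exact pow_le_pow_left₀ (Nat.cast_nonneg _)
    (Nat.cast_le.2 (labelledCount_layer_le S hH z)) 2

theorem SparseBound.variance_pair_layers_le (h : SparseBound π m K 4)
    {H : SimpleGraph (Fin 2)} (hH : ∀ a, ∃ b, H.Adj a b) :
    Var[fun ω => ∑ k : Fin m, (labelledCount S H (layerGraph (layer k ω)) : ℝ);
      modelMeasure n m π q] ≤ 7 * K ^ 2 * ((S.card : ℝ) ^ 2 / n) := by
  have hn : (0 : ℝ) < n := by exact_mod_cast h.pos
  have hK := h.one_le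
  refine (variance_labelledCount_layers_le q hH).trans ?_
  calc _ ≤ (K * n) * (7 * K * ((S.card : ℝ) / n) ^ 2) := by
        refine mul_le_mul h.layers (h.integral_two_sq_le q) ?_ (by positivity)
        exact integral_nonneg fun _ => by positivity
    _ = _ := by field_simp

theorem SparseBound.variance_triple_layers_le (h : SparseBound π m K 6)
    {H : SimpleGraph (Fin 3)} (hH : ∀ a, ∃ b, H.Adj a b) :
    Var[fun ω => ∑ k : Fin m, (labelledCount S H (layerGraph (layer k ω)) : ℝ);
      modelMeasure n m π q] ≤ 34 * K ^ 2 * ((S.card : ℝ) ^ 3 / (n : ℝ) ^ 2) := by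
  have hn : (0 : ℝ) < n := by exact_mod_cast h.pos
  have hK := h.one_le
  refine (variance_labelledCount_layers_le q hH).trans ?_
  calc _ ≤ (K * n) * (34 * K * ((S.card : ℝ) / n) ^ 3) := by
        refine mul_le_mul h.layers (h.integral_three_sq_le q) ?_ (by positivity)
        exact integral_nonneg fun _ => by positivity
    _ = _ := by field_simp

end LayerCopies

/-! ### Sums over pairs of distinct layers -/

section PairSums

variable {m : ℕ}

theorem sum_mul_sum_eq_diag_add_offDiag (a b : Fin m → ℝ) :
    (∑ k, a k) * ∑ k, b k
      = ∑ k, a k * b k + ∑ p ∈ (Finset.univ : Finset (Fin m)).offDiag, a p.1 * b p.2 := by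
  rw [Finset.sum_mul_sum, ← Finset.sum_product', ← Finset.diag_union_offDiag,
    Finset.sum_union (Finset.disjoint_diag_offDiag _), Finset.sum_diag]

/-- A number of events exceeds the indicator of their union by at most the number of ordered
pairs of distinct events. -/
theorem sum_le_add_sum_offDiag {y : Fin m → ℝ} (hy : ∀ k, y k = 0 ∨ y k = 1) {g : ℝ}
    (hg : 0 ≤ g) (h : ∀ k, y k ≤ g) :
    ∑ k, y k ≤ g + ∑ p ∈ (Finset.univ : Finset (Fin m)).offDiag, y p.1 * y p.2 := by
  have h0 : ∀ k, 0 ≤ y k := fun k => by rcases hy k with e | e <;> simp [e]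
  have hD : 0 ≤ ∑ p ∈ (Finset.univ : Finset (Fin m)).offDiag, y p.1 * y p.2 :=
    Finset.sum_nonneg fun p _ => mul_nonneg (h0 _) (h0 _)
  have hsq : ∑ k, y k * y k = ∑ k, y k :=
    Finset.sum_congr rfl fun k _ => by rcases hy k with e | e <;> simp [e]
  have hs := sum_mul_sum_eq_diag_add_offDiag y y
  rw [hsq] at hs
  by_cases hz : ∀ k, y k = 0
  · rw [Finset.sum_eq_zero fun k _ => hz k]
    linarith
  · push Not at hz
    obtain ⟨k₀, hk₀⟩ := hz
    have h1 : y k₀ = 1 := (hy k₀).resolve_left hk₀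
    have h2 : y k₀ ≤ ∑ k, y k := Finset.single_le_sum (fun k _ => h0 k) (Finset.mem_univ k₀)
    have h3 := h k₀
    -- `L ≤ 1 + L (L - 1)` for the sum `L`, since `(L - 1) ^ 2 ≥ 0`.
    nlinarith [sq_nonneg (∑ k, y k - 1)]

/-- The product of two numbers of events exceeds the product of the indicators `g`, `g'` of their
unions only through repetitions in one of the two families. -/
theorem sum_mul_sum_le_add_offDiag {a b : Fin m → ℝ} (ha : ∀ k, a k = 0 ∨ a k = 1)
    (hb : ∀ k, b k = 0 ∨ b k = 1) {g g' : ℝ} (hg : 0 ≤ g) (hg' : 0 ≤ g')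
    (hga : ∀ k, a k ≤ g) (hgb : ∀ k, b k ≤ g') (hsum : g ≤ ∑ k, a k) :
    (∑ k, a k) * ∑ k, b k ≤ g * g'
      + ((∑ p ∈ (Finset.univ : Finset (Fin m)).offDiag, a p.1 * a p.2) * ∑ k, b k)
      + (∑ p ∈ (Finset.univ : Finset (Fin m)).offDiag, b p.1 * b p.2) * ∑ k, a k := by
  have h0' : ∀ k, 0 ≤ b k := fun k => by rcases hb k with e | e <;> simp [e]
  have hB0 : 0 ≤ ∑ p ∈ (Finset.univ : Finset (Fin m)).offDiag, b p.1 * b p.2 :=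
    Finset.sum_nonneg fun p _ => mul_nonneg (h0' _) (h0' _)
  have hsb : 0 ≤ ∑ k, b k := Finset.sum_nonneg fun k _ => h0' k
  have e1 := mul_le_mul_of_nonneg_right (sum_le_add_sum_offDiag ha hg hga) hsb
  have e2 := mul_le_mul_of_nonneg_left (sum_le_add_sum_offDiag hb hg' hgb) hg
  have e3 := mul_le_mul_of_nonneg_right hsum hB0
  linarith

/-- The product of three sums is close to its diagonal part: the error is controlled by the
terms in which the first two, or the last two, of the three indices differ. -/
theorem abs_mul_mul_sub_sum_le {a b c : Fin m → ℝ} (ha : ∀ k, a k = 0 ∨ a k = 1)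
    (hb : ∀ k, b k = 0 ∨ b k = 1) (hc : ∀ k, c k = 0 ∨ c k = 1) {f g h : ℝ}
    (hf : 0 ≤ f) (hg : 0 ≤ g) (hh : 0 ≤ h)
    (hfa : ∀ k, a k ≤ f) (hgb : ∀ k, b k ≤ g) (hhc : ∀ k, c k ≤ h)
    (hfs : f ≤ ∑ k, a k) (hgs : g ≤ ∑ k, b k) (hhs : h ≤ ∑ k, c k) :
    |f * g * h - ∑ k, a k * b k * c k|
      ≤ (∑ p ∈ (Finset.univ : Finset (Fin m)).offDiag, a p.1 * b p.2) * (∑ k, c k)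
        + (∑ p ∈ (Finset.univ : Finset (Fin m)).offDiag, b p.1 * c p.2) * ∑ k, a k := by
  have a0 : ∀ k, 0 ≤ a k := fun k => by rcases ha k with e | e <;> simp [e]
  have b0 : ∀ k, 0 ≤ b k := fun k => by rcases hb k with e | e <;> simp [e]
  have c0 : ∀ k, 0 ≤ c k := fun k => by rcases hc k with e | e <;> simp [e]
  have a1 : ∀ k, a k ≤ 1 := fun k => by rcases ha k with e | e <;> simp [e]
  have c1 : ∀ k, c k ≤ 1 := fun k => by rcases hc k with e | e <;> simp [e]
  have sa0 : 0 ≤ ∑ k, a k := Finset.sum_nonneg fun k _ => a0 k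
  have sb0 : 0 ≤ ∑ k, b k := Finset.sum_nonneg fun k _ => b0 k
  have sc0 : 0 ≤ ∑ k, c k := Finset.sum_nonneg fun k _ => c0 k
  have hab0 : 0 ≤ ∑ p ∈ (Finset.univ : Finset (Fin m)).offDiag, a p.1 * b p.2 :=
    Finset.sum_nonneg fun p _ => mul_nonneg (a0 _) (b0 _)
  have hbc0 : 0 ≤ ∑ p ∈ (Finset.univ : Finset (Fin m)).offDiag, b p.1 * c p.2 :=
    Finset.sum_nonneg fun p _ => mul_nonneg (b0 _) (c0 _)
  have hup : f * g * h ≤ (∑ k, a k) * (∑ k, b k) * ∑ k, c k :=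
    mul_le_mul (mul_le_mul hfs hgs hg sa0) hhs hh (mul_nonneg sa0 sb0)
  have e1 := sum_mul_sum_eq_diag_add_offDiag a b
  have e2 := sum_mul_sum_eq_diag_add_offDiag (fun k => a k * b k) c
  have e3 : ∑ p ∈ (Finset.univ : Finset (Fin m)).offDiag, a p.1 * b p.1 * c p.2
      ≤ (∑ p ∈ (Finset.univ : Finset (Fin m)).offDiag, b p.1 * c p.2) * ∑ k, a k := by
    rw [Finset.sum_mul]
    refine Finset.sum_le_sum fun p _ => ?_
    have : a p.1 ≤ ∑ k, a k := Finset.single_le_sum (fun k _ => a0 k) (Finset.mem_univ p.1)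
    have := mul_le_mul_of_nonneg_left this (mul_nonneg (b0 p.1) (c0 p.2))
    linarith
  have hlow : ∑ k, a k * b k * c k ≤ f * g * h
      + ∑ p ∈ (Finset.univ : Finset (Fin m)).offDiag,
        a p.1 * b p.1 * c p.1 * (a p.2 * b p.2 * c p.2) := by
    refine sum_le_add_sum_offDiag (fun k => ?_) (mul_nonneg (mul_nonneg hf hg) hh) fun k =>
      mul_le_mul (mul_le_mul (hfa k) (hgb k) (b0 k) hf) (hhc k) (c0 k) (mul_nonneg hf hg)
    rcases ha k with e | e <;> rcases hb k with e' | e' <;> rcases hc k with e'' | e'' <;>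
      simp [e, e', e'']
  have e4 : ∑ p ∈ (Finset.univ : Finset (Fin m)).offDiag,
        a p.1 * b p.1 * c p.1 * (a p.2 * b p.2 * c p.2)
      ≤ (∑ p ∈ (Finset.univ : Finset (Fin m)).offDiag, a p.1 * b p.2) * ∑ k, c k := by
    rw [Finset.sum_mul]
    refine Finset.sum_le_sum fun p _ => ?_
    have h1 : c p.2 ≤ ∑ k, c k := Finset.single_le_sum (fun k _ => c0 k) (Finset.mem_univ p.2)
    have b1 : b p.1 ≤ 1 := by rcases hb p.1 with e | e <;> simp [e]
    have h2 : b p.1 * c p.1 * a p.2 ≤ 1 :=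
      mul_le_one₀ (mul_le_one₀ b1 (c0 _) (c1 _)) (a0 _) (a1 _)
    calc a p.1 * b p.1 * c p.1 * (a p.2 * b p.2 * c p.2)
        = (a p.1 * b p.2) * c p.2 * (b p.1 * c p.1 * a p.2) := by ring
      _ ≤ (a p.1 * b p.2) * c p.2 :=
          mul_le_of_le_one_right (mul_nonneg (mul_nonneg (a0 _) (b0 _)) (c0 _)) h2
      _ ≤ _ := mul_le_mul_of_nonneg_left h1 (mul_nonneg (a0 _) (b0 _))
  rw [abs_le]
  constructor
  · have := mul_nonneg hbc0 sa0
    linarith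
  · have : (∑ k, a k) * (∑ k, b k) * ∑ k, c k
        = ∑ k, a k * b k * c k
          + ∑ p ∈ (Finset.univ : Finset (Fin m)).offDiag, a p.1 * b p.1 * c p.2
          + (∑ p ∈ (Finset.univ : Finset (Fin m)).offDiag, a p.1 * b p.2) * ∑ k, c k := by
      rw [e1, add_mul, e2]
    linarith

end PairSums

/-! ### Configurations spread over several layers -/

theorem card_offDiag_univ_le (m : ℕ) :
    (((Finset.univ : Finset (Fin m)).offDiag.card : ℕ) : ℝ) ≤ (m : ℝ) ^ 2 := by
  have : (Finset.univ : Finset (Fin m)).offDiag.card ≤ m ^ 2 := by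
    rw [Finset.offDiag_card, Finset.card_univ, Fintype.card_fin, sq]
    exact Nat.sub_le _ _
  exact_mod_cast this

section Spread

variable {n m : ℕ} {π : PMF (Fin (n + 1))} {K : ℝ} (q : unitInterval)

/-- Two pairs of nodes that are linked through two different layers. -/
theorem SparseBound.integral_offDiag_le {R : ℕ} (h : SparseBound π m K R) (hR : 2 ≤ R)
    {A B : Finset (Fin n)} (hA : A.card = 2) (hB : B.card = 2) {u v : Layer n → ℝ}
    (hv0 : ∀ z, 0 ≤ v z)
    (hu : ∀ z, u z ≤ coverInd A z) (hv : ∀ z, v z ≤ coverInd B z) :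
    ∫ ω, ∑ p ∈ (Finset.univ : Finset (Fin m)).offDiag, u (layer p.1 ω) * v (layer p.2 ω)
      ∂modelMeasure n m π q ≤ K ^ 4 / (n : ℝ) ^ 2 := by
  have hn : (0 : ℝ) < n := by exact_mod_cast h.pos
  have hK := h.one_le
  have hp := h.cover 2 hR
  have hp0 := coverProb_nonneg π 2
  have hm := h.layers
  rw [integral_finsetSum _ fun _ _ => .of_finite]
  have h1 : ∀ p ∈ (Finset.univ : Finset (Fin m)).offDiag,
      ∫ ω, u (layer p.1 ω) * v (layer p.2 ω) ∂modelMeasure n m π q ≤ coverProb π 2 ^ 2 := by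
    intro p hp
    rw [integral_layer_mul π q (Finset.mem_offDiag.1 hp).2.2, sq]
    have hu' : ∫ z, u z ∂layerMeasure π q ≤ coverProb π 2 := by
      rw [← hA, ← integral_coverInd π q A]
      exact integral_mono .of_finite .of_finite hu
    have hv' : ∫ z, v z ∂layerMeasure π q ≤ coverProb π 2 := by
      rw [← hB, ← integral_coverInd π q B]
      exact integral_mono .of_finite .of_finite hv
    exact mul_le_mul hu' hv' (integral_nonneg hv0) hp0
  refine (Finset.sum_le_sum h1).trans ?_
  rw [Finset.sum_const, nsmul_eq_mul]
  calc _ ≤ (K * n) ^ 2 * (K / (n : ℝ) ^ 2) ^ 2 :=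
        mul_le_mul ((card_offDiag_univ_le m).trans (pow_le_pow_left₀ (Nat.cast_nonneg m) hm 2))
          (pow_le_pow_left₀ hp0 hp 2) (by positivity) (by positivity)
    _ = _ := by field_simp

/-- Three pairs among three nodes that are linked through at least two different layers. -/
theorem SparseBound.integral_offDiag_mul_sum_le {R : ℕ} (h : SparseBound π m K R) (hR : 3 ≤ R)
    {A B C : Finset (Fin n)} (hA : A.card = 2) (hB : B.card = 2) (hC : C.card = 2)
    (hAC : 3 ≤ (A ∪ C).card) (hBC : 3 ≤ (B ∪ C).card) {u v w : Layer n → ℝ}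
    (hu0 : ∀ z, 0 ≤ u z) (hv0 : ∀ z, 0 ≤ v z) (hw0 : ∀ z, 0 ≤ w z)
    (hu : ∀ z, u z ≤ coverInd A z) (hv : ∀ z, v z ≤ coverInd B z) (hw : ∀ z, w z ≤ coverInd C z) :
    ∫ ω, (∑ p ∈ (Finset.univ : Finset (Fin m)).offDiag, u (layer p.1 ω) * v (layer p.2 ω))
      * ∑ k : Fin m, w (layer k ω) ∂modelMeasure n m π q ≤ 3 * K ^ 6 / (n : ℝ) ^ 3 := by
  have hn : (0 : ℝ) < n := by exact_mod_cast h.pos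
  have hK := h.one_le
  have hp2 := h.cover 2 (by omega)
  have hp3 := h.cover 3 hR
  have hp20 := coverProb_nonneg π 2
  have hp30 := coverProb_nonneg π 3
  have hm := h.layers
  have hle : ∀ {X : Finset (Fin n)} {x : Layer n → ℝ}, X.card = 2 → (∀ z, x z ≤ coverInd X z) →
      ∫ z, x z ∂layerMeasure π q ≤ coverProb π 2 := by
    intro X x hX hx
    rw [← hX, ← integral_coverInd π q X]
    exact integral_mono .of_finite .of_finite hx
  have hle2 : ∀ {X Y : Finset (Fin n)} {x y : Layer n → ℝ}, 3 ≤ (X ∪ Y).card →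
      (∀ z, 0 ≤ x z) → (∀ z, 0 ≤ y z) → (∀ z, x z ≤ coverInd X z) → (∀ z, y z ≤ coverInd Y z) →
      ∫ z, x z * y z ∂layerMeasure π q ≤ coverProb π 3 := by
    intro X Y x y hXY hx0 hy0 hx hy
    obtain ⟨D, hD, hcard⟩ := Finset.exists_subset_card_eq hXY
    rw [← hcard, ← integral_coverInd π q D]
    refine integral_mono .of_finite .of_finite fun z => ?_
    calc x z * y z ≤ coverInd X z * coverInd Y z :=
          mul_le_mul (hx z) (hy z) (hy0 z) (coverInd_nonneg X z)
      _ = coverInd (X ∪ Y) z := coverInd_mul_coverInd X Y z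
      _ ≤ coverInd D z := coverInd_anti hD z
  simp_rw [Finset.sum_mul_sum]
  rw [integral_finsetSum _ fun _ _ => .of_finite]
  have h1 : ∀ p ∈ (Finset.univ : Finset (Fin m)).offDiag,
      ∫ ω, ∑ k : Fin m, u (layer p.1 ω) * v (layer p.2 ω) * w (layer k ω) ∂modelMeasure n m π q
        ≤ 2 * (coverProb π 3 * coverProb π 2) + m * coverProb π 2 ^ 3 := by
    intro p hp
    have hne := (Finset.mem_offDiag.1 hp).2.2
    rw [integral_finsetSum _ fun _ _ => .of_finite]
    have h32 : 0 ≤ coverProb π 3 * coverProb π 2 := mul_nonneg hp30 hp20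
    have h222 : 0 ≤ coverProb π 2 ^ 3 := by positivity
    have h2 : ∀ k : Fin m,
        ∫ ω, u (layer p.1 ω) * v (layer p.2 ω) * w (layer k ω) ∂modelMeasure n m π q
          ≤ (if k = p.1 then coverProb π 3 * coverProb π 2 else 0)
            + (if k = p.2 then coverProb π 3 * coverProb π 2 else 0) + coverProb π 2 ^ 3 := by
      intro k
      by_cases e1 : k = p.1
      · have e2 : k ≠ p.2 := fun e => hne (e1 ▸ e)
        rw [if_pos e1, if_neg e2, e1]
        have h3 := integral_layer_mul π q hne (fun z => u z * w z) v
        have h4 : ∫ ω, u (layer p.1 ω) * v (layer p.2 ω) * w (layer p.1 ω) ∂modelMeasure n m π q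
            = ∫ ω, u (layer p.1 ω) * w (layer p.1 ω) * v (layer p.2 ω) ∂modelMeasure n m π q :=
          integral_congr_ae (ae_of_all _ fun ω => by ring)
        rw [h4, h3]
        have := mul_le_mul (hle2 hAC hu0 hw0 hu hw) (hle hB hv) (integral_nonneg hv0) hp30
        linarith
      by_cases e2 : k = p.2
      · rw [if_neg e1, if_pos e2, e2]
        have h3 := integral_layer_mul π q hne u (fun z => v z * w z)
        have h4 : ∫ ω, u (layer p.1 ω) * v (layer p.2 ω) * w (layer p.2 ω) ∂modelMeasure n m π q
            = ∫ ω, u (layer p.1 ω) * (v (layer p.2 ω) * w (layer p.2 ω))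
              ∂modelMeasure n m π q :=
          integral_congr_ae (ae_of_all _ fun ω => by ring)
        rw [h4, h3]
        have := mul_le_mul (hle hA hu) (hle2 hBC hv0 hw0 hv hw)
          (integral_nonneg fun z => mul_nonneg (hv0 z) (hw0 z)) hp20
        linarith
      · rw [if_neg e1, if_neg e2,
          integral_layer_mul_mul π q hne (fun e => e1 e.symm) (fun e => e2 e.symm)]
        have := mul_le_mul (mul_le_mul (hle hA hu) (hle hB hv) (integral_nonneg hv0) hp20)
          (hle hC hw) (integral_nonneg hw0) (mul_nonneg hp20 hp20)
        linarith
    refine (Finset.sum_le_sum fun k _ => h2 k).trans (le_of_eq ?_)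
    simp [Finset.sum_add_distrib]
    ring
  refine (Finset.sum_le_sum h1).trans ?_
  rw [Finset.sum_const, nsmul_eq_mul]
  calc _ ≤ (K * n) ^ 2 * (2 * (K / (n : ℝ) ^ 3 * (K / (n : ℝ) ^ 2))
          + (K * n) * (K / (n : ℝ) ^ 2) ^ 3) := by
        refine mul_le_mul ((card_offDiag_univ_le m).trans (pow_le_pow_left₀ (Nat.cast_nonneg m) hm 2)) ?_
          (by positivity) (by positivity)
        refine add_le_add ?_ (mul_le_mul hm (pow_le_pow_left₀ hp20 hp2 3) (by positivity)
          (by positivity))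
        exact mul_le_mul_of_nonneg_left (mul_le_mul hp3 hp2 hp20 (by positivity)) (by norm_num)
    _ = (2 * K ^ 4 + K ^ 6) / (n : ℝ) ^ 3 := by field_simp
    _ ≤ _ := by
        have : K ^ 4 ≤ K ^ 6 := pow_le_pow_right₀ hK (by norm_num)
        gcongr
        linarith

end Spread

/-! ### Two-stars spread over two layers -/

section CrossStars

variable {n m : ℕ} (S : Finset (Fin n))

/-- The number of labelled two-stars whose first link is in the layer `z` and whose second link
is in the layer `w`. -/
noncomputable def crossStarCount (z w : Layer n) : ℝ :=
  ∑ φ ∈ labellings 3 S, adjInd (layerGraph z) (φ 0) (φ 1) * adjInd (layerGraph w) (φ 0) (φ 2)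

theorem crossStarCount_nonneg (z w : Layer n) : 0 ≤ crossStarCount S z w :=
  Finset.sum_nonneg fun _ _ => mul_nonneg (adjInd_nonneg _ _ _) (adjInd_nonneg _ _ _)

theorem crossStarCount_symm (z w : Layer n) : crossStarCount S z w = crossStarCount S w z := by
  unfold crossStarCount
  refine Finset.sum_equiv (Equiv.embeddingCongr (Equiv.swap (1 : Fin 3) 2) (Equiv.refl _))
    (fun φ => ?_) fun φ _ => ?_
  · rw [mem_labellings, mem_labellings]
    exact ⟨fun h a => h _, fun h a => by simpa using h (Equiv.swap (1 : Fin 3) 2 a)⟩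
  · have h0 : (Equiv.swap (1 : Fin 3) 2) 0 = 0 := by decide
    simp [Equiv.embeddingCongr, h0, mul_comm]

/-- The number of observed nodes other than `i` that share the community of `z` with `i`. -/
noncomputable def memberDegree (i : Fin n) (z : Layer n) : ℝ :=
  ∑ j ∈ S.erase i, coverInd {i, j} z

theorem memberDegree_nonneg (i : Fin n) (z : Layer n) : 0 ≤ memberDegree S i z :=
  Finset.sum_nonneg fun _ _ => coverInd_nonneg _ _

theorem sum_labellings_three_le (g : Fin n → Fin n → Fin n → ℝ) (hg : ∀ i j l, 0 ≤ g i j l) :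
    ∑ φ ∈ labellings 3 S, g (φ 0) (φ 1) (φ 2)
      ≤ ∑ i ∈ S, ∑ j ∈ S.erase i, ∑ l ∈ S.erase i, g i j l := by
  classical
  have hinj : Set.InjOn (fun φ : Fin 3 ↪ Fin n => (φ 0, φ 1, φ 2))
      (labellings 3 S : Set (Fin 3 ↪ Fin n)) := by
    intro φ _ ψ _ h
    have h0 : φ 0 = ψ 0 := congrArg Prod.fst h
    have h1 : φ 1 = ψ 1 := congrArg (fun x => x.2.1) h
    have h2 : φ 2 = ψ 2 := congrArg (fun x => x.2.2) h
    refine DFunLike.ext _ _ fun a => ?_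
    fin_cases a
    · exact h0
    · exact h1
    · exact h2
  have h1 : ∑ φ ∈ labellings 3 S, g (φ 0) (φ 1) (φ 2)
      = ∑ x ∈ (labellings 3 S).image (fun φ => (φ 0, φ 1, φ 2)), g x.1 x.2.1 x.2.2 := by
    rw [Finset.sum_image hinj]
  have h2 : ∑ i ∈ S, ∑ j ∈ S.erase i, ∑ l ∈ S.erase i, g i j l
      = ∑ x ∈ (S ×ˢ S ×ˢ S).filter (fun x => x.2.1 ≠ x.1 ∧ x.2.2 ≠ x.1), g x.1 x.2.1 x.2.2 := by
    rw [Finset.sum_filter, Finset.sum_product]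
    refine Finset.sum_congr rfl fun i _ => ?_
    rw [Finset.sum_product, ← Finset.filter_ne', Finset.sum_filter]
    refine Finset.sum_congr rfl fun j _ => ?_
    rw [Finset.sum_filter]
    by_cases hj : j = i <;> simp [hj]
  rw [h1, h2]
  refine Finset.sum_le_sum_of_subset_of_nonneg (fun x hx => ?_) fun x _ _ => hg _ _ _
  obtain ⟨φ, hφ, rfl⟩ := Finset.mem_image.1 hx
  have hφ' := mem_labellings.1 hφ
  refine Finset.mem_filter.2 ⟨?_, φ.injective.ne (by decide), φ.injective.ne (by decide)⟩
  exact Finset.mk_mem_product (hφ' 0) (Finset.mk_mem_product (hφ' 1) (hφ' 2))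

theorem crossStarCount_le (z w : Layer n) :
    crossStarCount S z w ≤ ∑ i ∈ S, memberDegree S i z * memberDegree S i w := by
  have h1 : crossStarCount S z w
      ≤ ∑ φ ∈ labellings 3 S, coverInd {φ 0, φ 1} z * coverInd {φ 0, φ 2} w :=
    Finset.sum_le_sum fun φ _ => mul_le_mul (adjInd_layer_le_coverInd _ _ _)
      (adjInd_layer_le_coverInd _ _ _) (adjInd_nonneg _ _ _) (coverInd_nonneg _ _)
  refine (h1.trans (sum_labellings_three_le S
    (fun i j l => coverInd {i, j} z * coverInd {i, l} w)
    fun i j l => mul_nonneg (coverInd_nonneg _ _) (coverInd_nonneg _ _))).trans (le_of_eq ?_)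
  simp_rw [memberDegree, Finset.sum_mul_sum]

/-- The total degree is the number of ordered pairs of distinct observed members. -/
theorem sum_memberDegree (z : Layer n) :
    ∑ i ∈ S, memberDegree S i z = (observedSize S z).descFactorial 2 := by
  classical
  have h : ∀ i ∈ S, memberDegree S i z
      = if i ∈ z.1 then ((observedSize S z - 1 : ℕ) : ℝ) else 0 := by
    intro i hi
    unfold memberDegree
    by_cases hz : i ∈ z.1
    · have h1 : ∀ j ∈ S.erase i, coverInd {i, j} z = if j ∈ z.1 then (1 : ℝ) else 0 := by
        intro j _
        simp [coverInd, Finset.insert_subset_iff, hz]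
      have h2 : (S.erase i).filter (fun j => j ∈ z.1) = (S ∩ z.1).erase i := by
        ext j; simp; tauto
      rw [if_pos hz, Finset.sum_congr rfl h1, ← Finset.sum_filter, h2, Finset.sum_const,
        Finset.card_erase_of_mem (Finset.mem_inter.2 ⟨hi, hz⟩), observedSize]
      simp
    · rw [if_neg hz]
      refine Finset.sum_eq_zero fun j _ => ?_
      simp [coverInd, Finset.insert_subset_iff, hz]
  rw [Finset.sum_congr rfl h, ← Finset.sum_filter, Finset.sum_const, nsmul_eq_mul,
    Finset.filter_mem_eq_inter]
  change ((observedSize S z : ℕ) : ℝ) * _ = _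
  rcases observedSize S z with _ | w
  · simp
  · simp
    ring

variable {S} {π : PMF (Fin (n + 1))} {K : ℝ} (q : unitInterval)

theorem SparseBound.integral_memberDegree_le {R : ℕ} (h : SparseBound π m K R) (hR : 2 ≤ R)
    (i : Fin n) :
    ∫ z, memberDegree S i z ∂layerMeasure π q ≤ K * S.card / (n : ℝ) ^ 2 := by
  have hp := h.cover 2 hR
  have hp0 := coverProb_nonneg π 2
  unfold memberDegree
  rw [integral_finsetSum _ fun _ _ => .of_finite]
  have h1 : ∀ j ∈ S.erase i, ∫ z, coverInd {i, j} z ∂layerMeasure π q = coverProb π 2 := by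
    intro j hj
    rw [integral_coverInd, Finset.card_pair (Finset.ne_of_mem_erase hj).symm]
  rw [Finset.sum_congr rfl h1, Finset.sum_const, nsmul_eq_mul]
  have : (((S.erase i).card : ℕ) : ℝ) ≤ S.card := by exact_mod_cast Finset.card_erase_le
  calc _ ≤ (S.card : ℝ) * (K / (n : ℝ) ^ 2) := mul_le_mul this hp hp0 (by positivity)
    _ = _ := by ring

theorem SparseBound.integral_memberDegree_sq_le {R : ℕ} (h : SparseBound π m K R) (hR : 3 ≤ R)
    (i : Fin n) :
    ∫ z, memberDegree S i z ^ 2 ∂layerMeasure π q ≤ 2 * K * S.card / (n : ℝ) ^ 2 := by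
  classical
  have hn : (0 : ℝ) < n := by exact_mod_cast h.pos
  have hK := h.one_le
  have hp2 := h.cover 2 (by omega)
  have hp3 := h.cover 3 hR
  have hp20 := coverProb_nonneg π 2
  have hp30 := coverProb_nonneg π 3
  have hS : (((S.erase i).card : ℕ) : ℝ) ≤ S.card := by exact_mod_cast Finset.card_erase_le
  have hSn : (S.card : ℝ) ≤ n := by
    have : S.card ≤ n := by simpa using S.card_le_univ
    exact_mod_cast this
  have h1 : ∀ z : Layer n, memberDegree S i z ^ 2
      = ∑ j ∈ S.erase i, ∑ l ∈ S.erase i, coverInd ({i, j} ∪ {i, l}) z := by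
    intro z
    simp_rw [sq, memberDegree, Finset.sum_mul_sum, coverInd_mul_coverInd]
  simp_rw [h1]
  rw [integral_finsetSum _ fun _ _ => .of_finite]
  have h2 : ∀ j ∈ S.erase i, ∫ z, ∑ l ∈ S.erase i, coverInd ({i, j} ∪ {i, l}) z ∂layerMeasure π q
      ≤ coverProb π 2 + S.card * coverProb π 3 := by
    intro j hj
    have hij := Finset.ne_of_mem_erase hj
    rw [integral_finsetSum _ fun _ _ => .of_finite]
    have h3 : ∀ l ∈ S.erase i, ∫ z, coverInd ({i, j} ∪ {i, l}) z ∂layerMeasure π q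
        ≤ (if l = j then coverProb π 2 else 0) + coverProb π 3 := by
      intro l hl
      have hil := Finset.ne_of_mem_erase hl
      rw [integral_coverInd]
      by_cases e : l = j
      · subst e
        rw [Finset.union_self, Finset.card_pair hil.symm, if_pos rfl]
        linarith
      · have : ({i, j} ∪ {i, l} : Finset (Fin n)) = {i, j, l} := by
          ext x; simp
        rw [this, Finset.card_eq_three.2 ⟨i, j, l, hij.symm, hil.symm, fun e' => e e'.symm, rfl⟩,
          if_neg e, zero_add]
    refine (Finset.sum_le_sum h3).trans ?_
    rw [Finset.sum_add_distrib, Finset.sum_ite_eq', if_pos hj, Finset.sum_const, nsmul_eq_mul]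
    have := mul_le_mul_of_nonneg_right hS hp30
    linarith
  refine (Finset.sum_le_sum h2).trans ?_
  rw [Finset.sum_const, nsmul_eq_mul]
  calc _ ≤ (S.card : ℝ) * (K / (n : ℝ) ^ 2 + n * (K / (n : ℝ) ^ 3)) := by
        refine mul_le_mul hS (add_le_add hp2 (mul_le_mul hSn hp3 hp30 hn.le)) ?_ (by positivity)
        positivity
    _ = _ := by field_simp; ring

theorem SparseBound.integral_memberDegree_mul_le {R : ℕ} (h : SparseBound π m K R) (hR : 3 ≤ R)
    (i j : Fin n) :
    ∫ z, memberDegree S i z * memberDegree S j z ∂layerMeasure π q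
      ≤ 2 * K * S.card / (n : ℝ) ^ 2 := by
  have h1 := h.integral_memberDegree_sq_le (S := S) q hR i
  have h2 := h.integral_memberDegree_sq_le (S := S) q hR j
  have h3 : ∫ z, memberDegree S i z * memberDegree S j z ∂layerMeasure π q
      ≤ ∫ z, (1 / 2 * memberDegree S i z ^ 2 + 1 / 2 * memberDegree S j z ^ 2)
        ∂layerMeasure π q := by
    refine integral_mono .of_finite .of_finite fun z => ?_
    change memberDegree S i z * memberDegree S j z ≤ _
    nlinarith [sq_nonneg (memberDegree S i z - memberDegree S j z)]
  rw [integral_add .of_finite .of_finite, integral_const_mul, integral_const_mul] at h3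
  linarith

theorem SparseBound.sum_integral_memberDegree_mul_le (h : SparseBound π m K 4) :
    ∑ i ∈ S, ∑ j ∈ S, ∫ z, memberDegree S i z * memberDegree S j z ∂layerMeasure π q
      ≤ 7 * K * ((S.card : ℝ) / n) ^ 2 := by
  refine le_trans (le_of_eq ?_) (h.integral_two_sq_le (S := S) q)
  simp_rw [← sum_memberDegree, sq, Finset.sum_mul_sum]
  rw [integral_finsetSum _ fun _ _ => .of_finite]
  refine Finset.sum_congr rfl fun i _ => ?_
  rw [integral_finsetSum _ fun _ _ => .of_finite]

theorem SparseBound.integral_crossStarCount_sq_le (h : SparseBound π m K 4) {k l : Fin m}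
    (hkl : k ≠ l) :
    ∫ ω, crossStarCount S (layer k ω) (layer l ω) ^ 2 ∂modelMeasure n m π q
      ≤ 14 * K ^ 2 * (S.card : ℝ) ^ 3 / (n : ℝ) ^ 4 := by
  have hn : (0 : ℝ) < n := by exact_mod_cast h.pos
  have hK := h.one_le
  calc _ ≤ ∫ ω, ∑ i ∈ S, ∑ j ∈ S, (memberDegree S i (layer k ω) * memberDegree S j (layer k ω))
          * (memberDegree S i (layer l ω) * memberDegree S j (layer l ω))
          ∂modelMeasure n m π q := by
        refine integral_mono .of_finite .of_finite fun ω => ?_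
        refine (pow_le_pow_left₀ (crossStarCount_nonneg S _ _) (crossStarCount_le S _ _) 2).trans
          (le_of_eq ?_)
        rw [sq, Finset.sum_mul_sum]
        exact Finset.sum_congr rfl fun i _ => Finset.sum_congr rfl fun j _ => by ring
    _ = ∑ i ∈ S, ∑ j ∈ S,
          (∫ z, memberDegree S i z * memberDegree S j z ∂layerMeasure π q)
          * ∫ z, memberDegree S i z * memberDegree S j z ∂layerMeasure π q := by
        rw [integral_finsetSum _ fun _ _ => .of_finite]
        refine Finset.sum_congr rfl fun i _ => ?_
        rw [integral_finsetSum _ fun _ _ => .of_finite]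
        refine Finset.sum_congr rfl fun j _ => ?_
        exact integral_layer_mul π q hkl (fun z => memberDegree S i z * memberDegree S j z)
          (fun z => memberDegree S i z * memberDegree S j z)
    _ ≤ ∑ i ∈ S, ∑ j ∈ S, (2 * K * S.card / (n : ℝ) ^ 2)
          * ∫ z, memberDegree S i z * memberDegree S j z ∂layerMeasure π q := by
        refine Finset.sum_le_sum fun i _ => Finset.sum_le_sum fun j _ => ?_
        refine mul_le_mul_of_nonneg_right (h.integral_memberDegree_mul_le q (by norm_num) i j) ?_
        exact integral_nonneg fun z =>
          mul_nonneg (memberDegree_nonneg S i z) (memberDegree_nonneg S j z)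
    _ = (2 * K * S.card / (n : ℝ) ^ 2) * ∑ i ∈ S, ∑ j ∈ S,
          ∫ z, memberDegree S i z * memberDegree S j z ∂layerMeasure π q := by
        simp_rw [Finset.mul_sum]
    _ ≤ (2 * K * S.card / (n : ℝ) ^ 2) * (7 * K * ((S.card : ℝ) / n) ^ 2) :=
        mul_le_mul_of_nonneg_left (h.sum_integral_memberDegree_mul_le q) (by positivity)
    _ = _ := by field_simp; ring

theorem SparseBound.integral_crossStarCount_mul_le (h : SparseBound π m K 4) {k l j : Fin m}
    (hkl : k ≠ l) (hkj : k ≠ j) (hlj : l ≠ j) :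
    ∫ ω, crossStarCount S (layer k ω) (layer l ω) * crossStarCount S (layer k ω) (layer j ω)
      ∂modelMeasure n m π q ≤ 7 * K ^ 3 * (S.card : ℝ) ^ 3 / (n : ℝ) ^ 5 := by
  have hn : (0 : ℝ) < n := by exact_mod_cast h.pos
  have hK := h.one_le
  have hSn : (S.card : ℝ) ≤ n := by
    have : S.card ≤ n := by simpa using S.card_le_univ
    exact_mod_cast this
  calc _ ≤ ∫ ω, ∑ i ∈ S, ∑ i' ∈ S,
          (memberDegree S i (layer k ω) * memberDegree S i' (layer k ω))
          * memberDegree S i (layer l ω) * memberDegree S i' (layer j ω)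
          ∂modelMeasure n m π q := by
        refine integral_mono .of_finite .of_finite fun ω => ?_
        refine (mul_le_mul (crossStarCount_le S _ _) (crossStarCount_le S _ _)
          (crossStarCount_nonneg S _ _) ?_).trans (le_of_eq ?_)
        · exact Finset.sum_nonneg fun i _ =>
            mul_nonneg (memberDegree_nonneg S i _) (memberDegree_nonneg S i _)
        · rw [Finset.sum_mul_sum]
          exact Finset.sum_congr rfl fun i _ => Finset.sum_congr rfl fun j _ => by ring
    _ = ∑ i ∈ S, ∑ i' ∈ S,
          (∫ z, memberDegree S i z * memberDegree S i' z ∂layerMeasure π q)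
          * (∫ z, memberDegree S i z ∂layerMeasure π q)
          * ∫ z, memberDegree S i' z ∂layerMeasure π q := by
        rw [integral_finsetSum _ fun _ _ => .of_finite]
        refine Finset.sum_congr rfl fun i _ => ?_
        rw [integral_finsetSum _ fun _ _ => .of_finite]
        refine Finset.sum_congr rfl fun i' _ => ?_
        exact integral_layer_mul_mul π q hkl hkj hlj
          (fun z => memberDegree S i z * memberDegree S i' z)
          (memberDegree S i) (memberDegree S i')
    _ ≤ ∑ i ∈ S, ∑ i' ∈ S, (K * S.card / (n : ℝ) ^ 2) ^ 2
          * ∫ z, memberDegree S i z * memberDegree S i' z ∂layerMeasure π q := by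
        refine Finset.sum_le_sum fun i _ => Finset.sum_le_sum fun i' _ => ?_
        have e1 := h.integral_memberDegree_le (S := S) q (by norm_num) i
        have e2 := h.integral_memberDegree_le (S := S) q (by norm_num) i'
        have n1 : 0 ≤ ∫ z, memberDegree S i z ∂layerMeasure π q :=
          integral_nonneg fun z => memberDegree_nonneg S i z
        have n2 : 0 ≤ ∫ z, memberDegree S i' z ∂layerMeasure π q :=
          integral_nonneg fun z => memberDegree_nonneg S i' z
        have n3 : 0 ≤ ∫ z, memberDegree S i z * memberDegree S i' z ∂layerMeasure π q :=
          integral_nonneg fun z =>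
            mul_nonneg (memberDegree_nonneg S i z) (memberDegree_nonneg S i' z)
        have := mul_le_mul_of_nonneg_left (mul_le_mul e1 e2 n2 (n1.trans e1)) n3
        rw [sq]
        linarith
    _ = (K * S.card / (n : ℝ) ^ 2) ^ 2 * ∑ i ∈ S, ∑ i' ∈ S,
          ∫ z, memberDegree S i z * memberDegree S i' z ∂layerMeasure π q := by
        simp_rw [Finset.mul_sum]
    _ ≤ (K * S.card / (n : ℝ) ^ 2) ^ 2 * (7 * K * ((S.card : ℝ) / n) ^ 2) :=
        mul_le_mul_of_nonneg_left (h.sum_integral_memberDegree_mul_le q) (by positivity)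
    _ = 7 * K ^ 3 * (S.card : ℝ) ^ 3 / (n : ℝ) ^ 6 * S.card := by field_simp
    _ ≤ 7 * K ^ 3 * (S.card : ℝ) ^ 3 / (n : ℝ) ^ 6 * n :=
        mul_le_mul_of_nonneg_left hSn (by positivity)
    _ = _ := by field_simp

theorem SparseBound.variance_crossStarCount_le (h : SparseBound π m K 4) :
    Var[fun ω => ∑ p ∈ (Finset.univ : Finset (Fin m)).offDiag,
        crossStarCount S (layer p.1 ω) (layer p.2 ω); modelMeasure n m π q]
      ≤ 84 * K ^ 6 * ((S.card : ℝ) ^ 3 / (n : ℝ) ^ 2) := by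
  have hn : (0 : ℝ) < n := by exact_mod_cast h.pos
  have hK := h.one_le
  have hm := h.layers
  have hm0 : (0 : ℝ) ≤ m := Nat.cast_nonneg m
  refine (variance_sum_layer_pairs_le π q (crossStarCount S) (crossStarCount_nonneg S)
    (crossStarCount_symm S) (by positivity) (by positivity)
    (fun k l hkl => h.integral_crossStarCount_sq_le q hkl)
    (fun k l j h1 h2 h3 => h.integral_crossStarCount_mul_le q h1 h2 h3)).trans ?_
  calc _ ≤ 4 * ((K * n) ^ 2 * (14 * K ^ 2 * (S.card : ℝ) ^ 3 / (n : ℝ) ^ 4)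
          + (K * n) ^ 3 * (7 * K ^ 3 * (S.card : ℝ) ^ 3 / (n : ℝ) ^ 5)) := by gcongr
    _ = (56 * K ^ 4 + 28 * K ^ 6) * ((S.card : ℝ) ^ 3 / (n : ℝ) ^ 2) := by field_simp; ring
    _ ≤ _ := by
        have : K ^ 4 ≤ K ^ 6 := pow_le_pow_right₀ hK (by norm_num)
        gcongr
        linarith

end CrossStars

/-! ### Concentration of the subgraph counts -/

/-- The common last step for the three counts: `X` is approximated by a main term `Y` and a further
nonnegative term `Z`, with variances of order `a` and an error of order `b`. -/
theorem deviation_and_mean_of_approx {Ω : Type*} [MeasurableSpace Ω] [Finite Ω]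
    [DiscreteMeasurableSpace Ω] (P : Measure Ω) [IsProbabilityMeasure P] {X Y Z R : Ω → ℝ}
    (h : ∀ ω, |X ω - (Y ω + Z ω)| ≤ R ω) (hZ : ∀ ω, 0 ≤ Z ω) {D a b : ℝ} (hD : 0 ≤ D)
    (hb : 0 ≤ b) (hVY : Var[Y; P] ≤ (6 * D) ^ 2 * a) (hVZ : Var[Z; P] ≤ (10 * D) ^ 2 * a)
    (hR : ∫ ω, R ω ∂P ≤ 8 * D * b) :
    meanAbsDev P X ≤ 16 * D * (√a + b) ∧ ∫ ω, Y ω ∂P - 16 * D * b ≤ ∫ ω, X ω ∂P := by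
  constructor
  · have h1 : √(Var[Y; P]) ≤ 6 * D * √a := by
      rw [← Real.sqrt_sq (by positivity : (0 : ℝ) ≤ 6 * D), ← Real.sqrt_mul (sq_nonneg _)]
      exact Real.sqrt_le_sqrt hVY
    have h2 : √(Var[Z; P]) ≤ 10 * D * √a := by
      rw [← Real.sqrt_sq (by positivity : (0 : ℝ) ≤ 10 * D), ← Real.sqrt_mul (sq_nonneg _)]
      exact Real.sqrt_le_sqrt hVZ
    have := meanAbsDev_le_of_approx P h
    linarith
  · have h1 : ∫ ω, Y ω ∂P ≤ ∫ ω, (X ω + R ω) ∂P := by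
      refine integral_mono .of_finite .of_finite fun ω => ?_
      have := (abs_le.1 (h ω)).1
      have := hZ ω
      change Y ω ≤ X ω + R ω
      linarith
    rw [integral_add .of_finite .of_finite] at h1
    have := mul_nonneg hD hb
    linarith

section Concentration

variable {n m : ℕ} {S : Finset (Fin n)} {π : PMF (Fin (n + 1))} {K : ℝ} (q : unitInterval)

theorem integral_labelledCount_layers {r : ℕ} {H : SimpleGraph (Fin r)}
    (hH : ∀ a, ∃ b, H.Adj a b) [Fintype H.edgeSet] :
    ∫ ω, ∑ k : Fin m, (labelledCount S H (layerGraph (layer k ω)) : ℝ) ∂modelMeasure n m π q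
      = m * (S.card.descFactorial r * (coverProb π r * (q : ℝ) ^ H.edgeFinset.card)) := by
  rw [integral_finsetSum _ fun _ _ => .of_finite]
  have h : ∀ k ∈ (Finset.univ : Finset (Fin m)),
      ∫ ω, (labelledCount S H (layerGraph (layer k ω)) : ℝ) ∂modelMeasure n m π q
        = S.card.descFactorial r * (coverProb π r * (q : ℝ) ^ H.edgeFinset.card) := by
    intro k _
    rw [integral_layer π q k fun z => (labelledCount S H (layerGraph z) : ℝ),
      integral_labelledCount_layer S π q hH]
  rw [Finset.sum_congr rfl h]
  simp

theorem integral_sum_labellings_le {r : ℕ} {F : (Fin r ↪ Fin n) → ModelSpace n m → ℝ} {c : ℝ}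
    (hc : 0 ≤ c) (hF : ∀ φ, ∫ ω, F φ ω ∂modelMeasure n m π q ≤ c) :
    ∫ ω, ∑ φ ∈ labellings r S, F φ ω ∂modelMeasure n m π q ≤ (S.card : ℝ) ^ r * c := by
  rw [integral_finsetSum _ fun _ _ => .of_finite]
  refine (Finset.sum_le_sum fun φ _ => hF φ).trans ?_
  rw [Finset.sum_const, nsmul_eq_mul, card_labellings]
  refine mul_le_mul_of_nonneg_right ?_ hc
  exact_mod_cast Nat.descFactorial_le_pow _ _

theorem top_two_no_isolated (a : Fin 2) : ∃ b, (⊤ : SimpleGraph (Fin 2)).Adj a b := by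
  fin_cases a
  · exact ⟨1, by simp⟩
  · exact ⟨0, by simp⟩

theorem top_three_no_isolated (a : Fin 3) : ∃ b, (⊤ : SimpleGraph (Fin 3)).Adj a b := by
  fin_cases a
  · exact ⟨1, by simp⟩
  · exact ⟨0, by simp⟩
  · exact ⟨0, by simp⟩

theorem star_no_isolated (a : Fin 3) :
    ∃ b, (SimpleGraph.starGraph (0 : Fin 3)).Adj a b := by
  fin_cases a
  · exact ⟨1, by simp⟩
  · exact ⟨0, by simp⟩
  · exact ⟨0, by simp⟩

/-- Almost all links are realised in exactly one layer. -/
theorem SparseBound.linkCount_concentration (h : SparseBound π m K 4) :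
    meanAbsDev (modelMeasure n m π q)
        (fun ω => (labelledCount S (⊤ : SimpleGraph (Fin 2)) (modelGraph ω) : ℝ))
      ≤ 16 * K ^ 6 * (√((S.card : ℝ) ^ 2 / n) + (S.card : ℝ) ^ 2 / (n : ℝ) ^ 2) ∧
    ∫ ω, ∑ k : Fin m, (labelledCount S (⊤ : SimpleGraph (Fin 2)) (layerGraph (layer k ω)) : ℝ)
        ∂modelMeasure n m π q - 16 * K ^ 6 * ((S.card : ℝ) ^ 2 / (n : ℝ) ^ 2)
      ≤ ∫ ω, (labelledCount S (⊤ : SimpleGraph (Fin 2)) (modelGraph ω) : ℝ)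
        ∂modelMeasure n m π q := by
  have hn : (0 : ℝ) < n := by exact_mod_cast h.pos
  have hK := h.one_le
  have hK6 : 1 ≤ K ^ 6 := one_le_pow₀ hK
  set a : (Fin 2 ↪ Fin n) → Fin m → ModelSpace n m → ℝ := fun φ k ω =>
    adjInd (layerGraph (layer k ω)) (φ 0) (φ 1) with ha
  refine deviation_and_mean_of_approx (modelMeasure n m π q) (Z := fun _ => 0)
    (R := fun ω => ∑ φ ∈ labellings 2 S, ∑ p ∈ (Finset.univ : Finset (Fin m)).offDiag,
      a φ p.1 ω * a φ p.2 ω) (fun ω => ?_) (fun _ => le_rfl) (by positivity) (by positivity)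
    ?_ ?_ ?_
  · simp_rw [labelledCount_top_two, add_zero]
    rw [Finset.sum_comm, ← Finset.sum_sub_distrib]
    refine (Finset.abs_sum_le_sum_abs _ _).trans (Finset.sum_le_sum fun φ _ => ?_)
    have h1 := sum_le_add_sum_offDiag (y := fun k => a φ k ω)
      (fun k => adjInd_eq_zero_or_one _ _ _) (adjInd_nonneg (modelGraph ω) (φ 0) (φ 1))
      (fun k => adjInd_layer_le_adjInd_model ω k _ _)
    have h2 := adjInd_model_le_sum ω (φ 0) (φ 1)
    have h3 : 0 ≤ ∑ p ∈ (Finset.univ : Finset (Fin m)).offDiag, a φ p.1 ω * a φ p.2 ω :=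
      Finset.sum_nonneg fun p _ => mul_nonneg (adjInd_nonneg _ _ _) (adjInd_nonneg _ _ _)
    rw [abs_le]
    constructor <;> linarith
  · refine (h.variance_pair_layers_le q top_two_no_isolated).trans ?_
    have : 7 * K ^ 2 ≤ (6 * K ^ 6) ^ 2 := by
      have : K ^ 2 ≤ K ^ 12 := pow_le_pow_right₀ hK (by norm_num)
      nlinarith
    exact mul_le_mul_of_nonneg_right this (by positivity)
  · refine (variance_zero _).le.trans ?_
    positivity
  · refine (integral_sum_labellings_le q (c := K ^ 4 / (n : ℝ) ^ 2) (by positivity)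
      fun φ => ?_).trans ?_
    · have hc : ({φ 0, φ 1} : Finset (Fin n)).card = 2 :=
        Finset.card_pair (φ.injective.ne (by decide))
      exact h.integral_offDiag_le q (by norm_num) hc hc (fun z => adjInd_nonneg _ _ _)
        (fun z => adjInd_layer_le_coverInd z _ _) (fun z => adjInd_layer_le_coverInd z _ _)
    · have : K ^ 4 ≤ 8 * K ^ 6 := by
        have : K ^ 4 ≤ K ^ 6 := pow_le_pow_right₀ hK (by norm_num)
        linarith
      calc _ = K ^ 4 * ((S.card : ℝ) ^ 2 / (n : ℝ) ^ 2) := by ring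
        _ ≤ _ := mul_le_mul_of_nonneg_right this (by positivity)

theorem three_le_card_union_pair (φ : Fin 3 ↪ Fin n) {i j k l : Fin 3}
    (h : ∀ x, x = i ∨ x = j ∨ x = k ∨ x = l) :
    3 ≤ (({φ i, φ j} : Finset (Fin n)) ∪ {φ k, φ l}).card := by
  have h1 : Finset.univ.map φ ⊆ ({φ i, φ j} : Finset (Fin n)) ∪ {φ k, φ l} := by
    intro x hx
    obtain ⟨a, -, rfl⟩ := Finset.mem_map.1 hx
    rcases h a with e | e | e | e <;> simp [e]
  simpa using Finset.card_le_card h1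

/-- Two-stars inside one layer and two-stars spread over two layers have means of the same
order. -/
theorem SparseBound.twoStarCount_concentration (h : SparseBound π m K 6) :
    meanAbsDev (modelMeasure n m π q)
        (fun ω => (labelledCount S (SimpleGraph.starGraph (0 : Fin 3)) (modelGraph ω) : ℝ))
      ≤ 16 * K ^ 6 * (√((S.card : ℝ) ^ 3 / (n : ℝ) ^ 2) + (S.card : ℝ) ^ 3 / (n : ℝ) ^ 3) ∧
    ∫ ω, ∑ k : Fin m,
        (labelledCount S (SimpleGraph.starGraph (0 : Fin 3)) (layerGraph (layer k ω)) : ℝ)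
        ∂modelMeasure n m π q - 16 * K ^ 6 * ((S.card : ℝ) ^ 3 / (n : ℝ) ^ 3)
      ≤ ∫ ω, (labelledCount S (SimpleGraph.starGraph (0 : Fin 3)) (modelGraph ω) : ℝ)
        ∂modelMeasure n m π q := by
  have hn : (0 : ℝ) < n := by exact_mod_cast h.pos
  have hK := h.one_le
  have h4 : SparseBound π m K 4 :=
    ⟨h.pos, h.one_le, h.layers, fun r hr => h.cover r (hr.trans (by norm_num))⟩
  have hK6 : 1 ≤ K ^ 6 := one_le_pow₀ hK
  set a : (Fin 3 ↪ Fin n) → Fin m → ModelSpace n m → ℝ := fun φ k ω =>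
    adjInd (layerGraph (layer k ω)) (φ 0) (φ 1) with ha
  set b : (Fin 3 ↪ Fin n) → Fin m → ModelSpace n m → ℝ := fun φ k ω =>
    adjInd (layerGraph (layer k ω)) (φ 0) (φ 2) with hb
  refine deviation_and_mean_of_approx (modelMeasure n m π q)
    (Z := fun ω => ∑ p ∈ (Finset.univ : Finset (Fin m)).offDiag,
        crossStarCount S (layer p.1 ω) (layer p.2 ω))
    (R := fun ω => ∑ φ ∈ labellings 3 S,
      ((∑ p ∈ (Finset.univ : Finset (Fin m)).offDiag, a φ p.1 ω * a φ p.2 ω)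
          * (∑ k, b φ k ω)
        + (∑ p ∈ (Finset.univ : Finset (Fin m)).offDiag, b φ p.1 ω * b φ p.2 ω)
          * ∑ k, a φ k ω)) (fun ω => ?_)
    (fun ω => Finset.sum_nonneg fun p _ => crossStarCount_nonneg S _ _)
    (by positivity) (by positivity) ?_ ?_ ?_
  · simp_rw [labelledCount_star, crossStarCount]
    rw [Finset.sum_comm, Finset.sum_comm (s := (Finset.univ : Finset (Fin m)).offDiag),
      ← Finset.sum_add_distrib, ← Finset.sum_sub_distrib]
    refine (Finset.abs_sum_le_sum_abs _ _).trans (Finset.sum_le_sum fun φ _ => ?_)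
    have e := sum_mul_sum_eq_diag_add_offDiag (fun k => a φ k ω) (fun k => b φ k ω)
    have h1 := sum_mul_sum_le_add_offDiag (a := fun k => a φ k ω) (b := fun k => b φ k ω)
      (fun k => adjInd_eq_zero_or_one _ _ _) (fun k => adjInd_eq_zero_or_one _ _ _)
      (adjInd_nonneg (modelGraph ω) (φ 0) (φ 1)) (adjInd_nonneg (modelGraph ω) (φ 0) (φ 2))
      (fun k => adjInd_layer_le_adjInd_model ω k _ _)
      (fun k => adjInd_layer_le_adjInd_model ω k _ _) (adjInd_model_le_sum ω _ _)
    have sa0 : 0 ≤ ∑ k, a φ k ω := Finset.sum_nonneg fun k _ => adjInd_nonneg _ _ _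
    have sb0 : 0 ≤ ∑ k, b φ k ω := Finset.sum_nonneg fun k _ => adjInd_nonneg _ _ _
    have h2 : adjInd (modelGraph ω) (φ 0) (φ 1) * adjInd (modelGraph ω) (φ 0) (φ 2)
        ≤ (∑ k, a φ k ω) * ∑ k, b φ k ω :=
      mul_le_mul (adjInd_model_le_sum ω _ _) (adjInd_model_le_sum ω _ _) (adjInd_nonneg _ _ _) sa0
    have h3 : 0 ≤ ∑ p ∈ (Finset.univ : Finset (Fin m)).offDiag, a φ p.1 ω * a φ p.2 ω :=
      Finset.sum_nonneg fun p _ => mul_nonneg (adjInd_nonneg _ _ _) (adjInd_nonneg _ _ _)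
    have h4 : 0 ≤ ∑ p ∈ (Finset.univ : Finset (Fin m)).offDiag, b φ p.1 ω * b φ p.2 ω :=
      Finset.sum_nonneg fun p _ => mul_nonneg (adjInd_nonneg _ _ _) (adjInd_nonneg _ _ _)
    have h5 := mul_nonneg h3 sb0
    have h6 := mul_nonneg h4 sa0
    rw [← e, abs_le]
    constructor <;> linarith
  · refine (h.variance_triple_layers_le q star_no_isolated).trans ?_
    have : 34 * K ^ 2 ≤ (6 * K ^ 6) ^ 2 := by
      have : K ^ 2 ≤ K ^ 12 := pow_le_pow_right₀ hK (by norm_num)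
      nlinarith
    exact mul_le_mul_of_nonneg_right this (by positivity)
  · refine (h4.variance_crossStarCount_le q).trans ?_
    have : 84 * K ^ 6 ≤ (10 * K ^ 6) ^ 2 := by nlinarith
    exact mul_le_mul_of_nonneg_right this (by positivity)
  · have h01 : ∀ φ : Fin 3 ↪ Fin n, ({φ 0, φ 1} : Finset (Fin n)).card = 2 := fun φ =>
      Finset.card_pair (φ.injective.ne (by decide))
    have h02 : ∀ φ : Fin 3 ↪ Fin n, ({φ 0, φ 2} : Finset (Fin n)).card = 2 := fun φ =>
      Finset.card_pair (φ.injective.ne (by decide))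
    refine (integral_sum_labellings_le q (c := 6 * K ^ 6 / (n : ℝ) ^ 3) (by positivity)
      fun φ => ?_).trans ?_
    · rw [integral_add .of_finite .of_finite]
      have hu := three_le_card_union_pair φ (i := 0) (j := 1) (k := 0) (l := 2) (by decide)
      have hu' := three_le_card_union_pair φ (i := 0) (j := 2) (k := 0) (l := 1) (by decide)
      have e1 := h.integral_offDiag_mul_sum_le q (by norm_num) (h01 φ) (h01 φ) (h02 φ) hu hu
        (fun z => adjInd_nonneg (layerGraph z) (φ 0) (φ 1))
        (fun z => adjInd_nonneg (layerGraph z) (φ 0) (φ 1))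
        (fun z => adjInd_nonneg (layerGraph z) (φ 0) (φ 2))
        (fun z => adjInd_layer_le_coverInd z _ _) (fun z => adjInd_layer_le_coverInd z _ _)
        (fun z => adjInd_layer_le_coverInd z _ _)
      have e2 := h.integral_offDiag_mul_sum_le q (by norm_num) (h02 φ) (h02 φ) (h01 φ) hu' hu'
        (fun z => adjInd_nonneg (layerGraph z) (φ 0) (φ 2))
        (fun z => adjInd_nonneg (layerGraph z) (φ 0) (φ 2))
        (fun z => adjInd_nonneg (layerGraph z) (φ 0) (φ 1))
        (fun z => adjInd_layer_le_coverInd z _ _) (fun z => adjInd_layer_le_coverInd z _ _)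
        (fun z => adjInd_layer_le_coverInd z _ _)
      refine (add_le_add e1 e2).trans (le_of_eq ?_)
      ring
    · have : 6 * K ^ 6 ≤ 8 * K ^ 6 := by linarith
      calc _ = 6 * K ^ 6 * ((S.card : ℝ) ^ 3 / (n : ℝ) ^ 3) := by ring
        _ ≤ _ := mul_le_mul_of_nonneg_right this (by positivity)

/-- Almost all triangles are realised inside one layer. -/
theorem SparseBound.triangleCount_concentration (h : SparseBound π m K 6) :
    meanAbsDev (modelMeasure n m π q)
        (fun ω => (labelledCount S (⊤ : SimpleGraph (Fin 3)) (modelGraph ω) : ℝ))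
      ≤ 16 * K ^ 6 * (√((S.card : ℝ) ^ 3 / (n : ℝ) ^ 2) + (S.card : ℝ) ^ 3 / (n : ℝ) ^ 3) ∧
    ∫ ω, ∑ k : Fin m, (labelledCount S (⊤ : SimpleGraph (Fin 3)) (layerGraph (layer k ω)) : ℝ)
        ∂modelMeasure n m π q - 16 * K ^ 6 * ((S.card : ℝ) ^ 3 / (n : ℝ) ^ 3)
      ≤ ∫ ω, (labelledCount S (⊤ : SimpleGraph (Fin 3)) (modelGraph ω) : ℝ)
        ∂modelMeasure n m π q := by
  have hn : (0 : ℝ) < n := by exact_mod_cast h.pos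
  have hK := h.one_le
  have hK6 : 1 ≤ K ^ 6 := one_le_pow₀ hK
  set a : (Fin 3 ↪ Fin n) → Fin m → ModelSpace n m → ℝ := fun φ k ω =>
    adjInd (layerGraph (layer k ω)) (φ 0) (φ 1) with ha
  set b : (Fin 3 ↪ Fin n) → Fin m → ModelSpace n m → ℝ := fun φ k ω =>
    adjInd (layerGraph (layer k ω)) (φ 1) (φ 2) with hb
  set c : (Fin 3 ↪ Fin n) → Fin m → ModelSpace n m → ℝ := fun φ k ω =>
    adjInd (layerGraph (layer k ω)) (φ 0) (φ 2) with hc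
  refine deviation_and_mean_of_approx (modelMeasure n m π q) (Z := fun _ => 0)
    (R := fun ω => ∑ φ ∈ labellings 3 S,
      ((∑ p ∈ (Finset.univ : Finset (Fin m)).offDiag, a φ p.1 ω * b φ p.2 ω)
          * (∑ k, c φ k ω)
        + (∑ p ∈ (Finset.univ : Finset (Fin m)).offDiag, b φ p.1 ω * c φ p.2 ω)
          * ∑ k, a φ k ω)) (fun ω => ?_) (fun _ => le_rfl)
    (by positivity) (by positivity) ?_ ?_ ?_
  · simp_rw [labelledCount_top_three, add_zero]
    rw [Finset.sum_comm, ← Finset.sum_sub_distrib]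
    refine (Finset.abs_sum_le_sum_abs _ _).trans (Finset.sum_le_sum fun φ _ => ?_)
    exact abs_mul_mul_sub_sum_le (a := fun k => a φ k ω) (b := fun k => b φ k ω)
      (c := fun k => c φ k ω) (fun k => adjInd_eq_zero_or_one _ _ _)
      (fun k => adjInd_eq_zero_or_one _ _ _) (fun k => adjInd_eq_zero_or_one _ _ _)
      (adjInd_nonneg _ _ _) (adjInd_nonneg _ _ _) (adjInd_nonneg _ _ _)
      (fun k => adjInd_layer_le_adjInd_model ω k _ _)
      (fun k => adjInd_layer_le_adjInd_model ω k _ _)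
      (fun k => adjInd_layer_le_adjInd_model ω k _ _)
      (adjInd_model_le_sum ω _ _) (adjInd_model_le_sum ω _ _) (adjInd_model_le_sum ω _ _)
  · refine (h.variance_triple_layers_le q top_three_no_isolated).trans ?_
    have : 34 * K ^ 2 ≤ (6 * K ^ 6) ^ 2 := by
      have : K ^ 2 ≤ K ^ 12 := pow_le_pow_right₀ hK (by norm_num)
      nlinarith
    exact mul_le_mul_of_nonneg_right this (by positivity)
  · refine (variance_zero _).le.trans ?_
    positivity
  · have h01 : ∀ φ : Fin 3 ↪ Fin n, ({φ 0, φ 1} : Finset (Fin n)).card = 2 := fun φ =>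
      Finset.card_pair (φ.injective.ne (by decide))
    have h12 : ∀ φ : Fin 3 ↪ Fin n, ({φ 1, φ 2} : Finset (Fin n)).card = 2 := fun φ =>
      Finset.card_pair (φ.injective.ne (by decide))
    have h02 : ∀ φ : Fin 3 ↪ Fin n, ({φ 0, φ 2} : Finset (Fin n)).card = 2 := fun φ =>
      Finset.card_pair (φ.injective.ne (by decide))
    refine (integral_sum_labellings_le q (c := 6 * K ^ 6 / (n : ℝ) ^ 3) (by positivity)
      fun φ => ?_).trans ?_
    · rw [integral_add .of_finite .of_finite]
      have e1 := h.integral_offDiag_mul_sum_le q (by norm_num) (h01 φ) (h12 φ) (h02 φ)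
        (three_le_card_union_pair φ (by decide)) (three_le_card_union_pair φ (by decide))
        (fun z => adjInd_nonneg (layerGraph z) (φ 0) (φ 1))
        (fun z => adjInd_nonneg (layerGraph z) (φ 1) (φ 2))
        (fun z => adjInd_nonneg (layerGraph z) (φ 0) (φ 2))
        (fun z => adjInd_layer_le_coverInd z _ _) (fun z => adjInd_layer_le_coverInd z _ _)
        (fun z => adjInd_layer_le_coverInd z _ _)
      have e2 := h.integral_offDiag_mul_sum_le q (by norm_num) (h12 φ) (h02 φ) (h01 φ)
        (three_le_card_union_pair φ (by decide)) (three_le_card_union_pair φ (by decide))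
        (fun z => adjInd_nonneg (layerGraph z) (φ 1) (φ 2))
        (fun z => adjInd_nonneg (layerGraph z) (φ 0) (φ 2))
        (fun z => adjInd_nonneg (layerGraph z) (φ 0) (φ 1))
        (fun z => adjInd_layer_le_coverInd z _ _) (fun z => adjInd_layer_le_coverInd z _ _)
        (fun z => adjInd_layer_le_coverInd z _ _)
      refine (add_le_add e1 e2).trans (le_of_eq ?_)
      ring
    · have : 6 * K ^ 6 ≤ 8 * K ^ 6 := by linarith
      calc _ = 6 * K ^ 6 * ((S.card : ℝ) ^ 3 / (n : ℝ) ^ 3) := by ring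
        _ ≤ _ := mul_le_mul_of_nonneg_right this (by positivity)

end Concentration

/-! ### From concentration to convergence in probability -/

section Asymptotic

/-- By Markov's inequality, a relative mean absolute deviation tending to zero suffices. -/
theorem eqOneAddLittleOPMean_of_meanAbsDev {Ω : ℕ → Type*} [∀ ν, MeasurableSpace (Ω ν)]
    [∀ ν, Finite (Ω ν)] [∀ ν, DiscreteMeasurableSpace (Ω ν)] (P : ∀ ν, Measure (Ω ν))
    [∀ ν, IsProbabilityMeasure (P ν)] {N : ∀ ν, Ω ν → ℝ} (h0 : ∀ ν ω, 0 ≤ N ν ω)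
    (h : Tendsto (fun ν => meanAbsDev (P ν) (N ν) / ∫ ω, N ν ω ∂P ν) atTop (𝓝 0)) :
    EqOneAddLittleOPMean P N := by
  refine ⟨fun ν => .of_finite, fun ν ω => (N ν ω - ∫ ω', N ν ω' ∂P ν) / ∫ ω', N ν ω' ∂P ν,
    fun ν => Measurable.of_discrete, fun ε hε => ?_, fun ν => ?_⟩
  · have hE : ∀ ν, 0 ≤ ∫ ω, N ν ω ∂P ν := fun ν => integral_nonneg (h0 ν)
    have hint : ∀ ν, ∫ ω, |(N ν ω - ∫ ω', N ν ω' ∂P ν) / ∫ ω', N ν ω' ∂P ν| ∂P ν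
        = meanAbsDev (P ν) (N ν) / ∫ ω, N ν ω ∂P ν := by
      intro ν
      simp_rw [abs_div, abs_of_nonneg (hE ν)]
      rw [integral_div, meanAbsDev]
    have hle : ∀ ν, P ν {ω | ε < |(N ν ω - ∫ ω', N ν ω' ∂P ν) / ∫ ω', N ν ω' ∂P ν|}
        ≤ ENNReal.ofReal ((meanAbsDev (P ν) (N ν) / ∫ ω, N ν ω ∂P ν) / ε) := by
      intro ν
      have hM := mul_meas_ge_le_integral_of_nonneg (μ := P ν)
        (f := fun ω => |(N ν ω - ∫ ω', N ν ω' ∂P ν) / ∫ ω', N ν ω' ∂P ν|)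
        (ae_of_all _ fun _ => abs_nonneg _) .of_finite ε
      rw [hint] at hM
      refine (measure_mono (t := {ω | ε ≤ |(N ν ω - ∫ ω', N ν ω' ∂P ν) / ∫ ω', N ν ω' ∂P ν|})
        fun ω hω => le_of_lt (Set.mem_ofPred_eq ▸ hω)).trans ?_
      rw [← ofReal_measureReal]
      exact ENNReal.ofReal_le_ofReal ((le_div_iff₀' hε).2 hM)
    have hlim : Tendsto (fun ν => ENNReal.ofReal
        ((meanAbsDev (P ν) (N ν) / ∫ ω, N ν ω ∂P ν) / ε)) atTop (𝓝 0) := by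
      have := ENNReal.tendsto_ofReal (h.div_const ε)
      simpa using this
    exact tendsto_of_tendsto_of_tendsto_of_le_of_le tendsto_const_nhds hlim
      (fun _ => zero_le) hle
  · by_cases hE : ∫ ω, N ν ω ∂P ν = 0
    · -- A nonnegative variable with mean zero vanishes almost surely.
      have := (integral_eq_zero_iff_of_nonneg (h0 ν) .of_finite).1 hE
      filter_upwards [this] with ω hω
      simpa [hE] using hω
    · refine ae_of_all _ fun ω => ?_
      field_simp
      ring

theorem EqOneAddLittleOPMean.of_const_mul {Ω : ℕ → Type*} [∀ ν, MeasurableSpace (Ω ν)]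
    {P : ∀ ν, Measure (Ω ν)} {N : ∀ ν, Ω ν → ℝ} {c : ℝ} (hc : c ≠ 0)
    (h : EqOneAddLittleOPMean P fun ν ω => c * N ν ω) : EqOneAddLittleOPMean P N := by
  obtain ⟨hi, X, hX, hP, hN⟩ := h
  refine ⟨fun ν => ?_, X, hX, hP, fun ν => ?_⟩
  · exact (integrable_const_mul_iff (isUnit_iff_ne_zero.2 hc) _).1 (hi ν)
  · filter_upwards [hN ν] with ω hω
    rw [integral_const_mul] at hω
    refine mul_left_cancel₀ hc ?_
    rw [hω]
    ring

theorem tendsto_div_of_deviation_le {a s D E : ℕ → ℝ} {C c : ℝ} (hC : 0 ≤ C) (hc : 0 < c)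
    (ha : Tendsto a atTop atTop) (hs : Tendsto s atTop atTop) (hD0 : ∀ ν, 0 ≤ D ν)
    (hD : ∀ᶠ ν in atTop, D ν ≤ C * (√(a ν) + a ν / s ν))
    (hE : ∀ᶠ ν in atTop, c * a ν - C * (a ν / s ν) ≤ E ν) :
    Tendsto (fun ν => D ν / E ν) atTop (𝓝 0) := by
  have hlim : Tendsto (fun ν => 2 * C / c * ((√(a ν))⁻¹ + (s ν)⁻¹)) atTop (𝓝 0) := by
    have h1 := (tendsto_inv_atTop_zero.comp (Real.tendsto_sqrt_atTop.comp ha)).add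
      (tendsto_inv_atTop_zero.comp hs)
    simpa using h1.const_mul (2 * C / c)
  have hbounds : ∀ᶠ ν in atTop, 0 ≤ D ν / E ν
      ∧ D ν / E ν ≤ 2 * C / c * ((√(a ν))⁻¹ + (s ν)⁻¹) := by
    filter_upwards [hD, hE, ha.eventually_gt_atTop 0, hs.eventually_gt_atTop 0,
      hs.eventually_ge_atTop (2 * C / c)] with ν h1 h2 ha0 hs0 hsC
    have h3 : C * (a ν / s ν) ≤ c / 2 * a ν := by
      rw [div_le_iff₀ hc] at hsC
      rw [← mul_div_assoc, div_le_iff₀ hs0]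
      nlinarith
    have h4 : c / 2 * a ν ≤ E ν := by linarith
    have h5 : 0 < c / 2 * a ν := by positivity
    refine ⟨div_nonneg (hD0 ν) (h5.le.trans h4), ?_⟩
    calc D ν / E ν ≤ C * (√(a ν) + a ν / s ν) / (c / 2 * a ν) :=
          div_le_div₀ (by positivity) h1 h5 h4
      _ = _ := by
          have hsq : √(a ν) * √(a ν) = a ν := Real.mul_self_sqrt ha0.le
          have hpos : 0 < √(a ν) := Real.sqrt_pos.2 ha0
          have : (√(a ν) + a ν / s ν) / a ν = (√(a ν))⁻¹ + (s ν)⁻¹ := by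
            nth_rewrite 2 3 [← hsq]
            field_simp
          rw [← this]
          field_simp
  exact tendsto_of_tendsto_of_tendsto_of_le_of_le' tendsto_const_nhds hlim
    (hbounds.mono fun _ h => h.1) (hbounds.mono fun _ h => h.2)

/-- The condition `n ^ (l / k) = o(n₀)` says that `n₀ ^ k / n ^ l` tends to infinity. -/
theorem tendsto_pow_div_pow_atTop {n n₀ : ℕ → ℕ} (hn : Tendsto n atTop atTop) {k l : ℕ}
    (hk : k ≠ 0) (h : (fun ν => (n ν : ℝ) ^ ((l : ℝ) / k)) =o[atTop] fun ν => (n₀ ν : ℝ)) :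
    Tendsto (fun ν => (n₀ ν : ℝ) ^ k / (n ν : ℝ) ^ l) atTop atTop := by
  refine tendsto_atTop.2 fun b => ?_
  set B : ℝ := |b| + 1 with hB
  have hB1 : 1 ≤ B := by linarith [abs_nonneg b]
  have hB0 : 0 < B := by linarith
  filter_upwards [h.def (inv_pos.2 hB0), hn.eventually_gt_atTop 0] with ν h1 hpos
  have hn0 : (0 : ℝ) < n ν := by exact_mod_cast hpos
  rw [Real.norm_of_nonneg (by positivity), Real.norm_of_nonneg (by positivity),
    inv_mul_eq_div, le_div_iff₀ hB0] at h1
  have h2 := pow_le_pow_left₀ (by positivity) h1 k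
  rw [mul_pow, ← Real.rpow_natCast, ← Real.rpow_mul hn0.le,
    div_mul_cancel₀ _ (by exact_mod_cast hk), Real.rpow_natCast] at h2
  rw [le_div_iff₀ (by positivity)]
  calc b * (n ν : ℝ) ^ l ≤ B ^ k * (n ν : ℝ) ^ l := by
        refine mul_le_mul_of_nonneg_right ?_ (by positivity)
        calc b ≤ B := by linarith [le_abs_self b]
          _ ≤ B ^ k := le_self_pow₀ hB1 hk
    _ ≤ _ := by linarith

end Asymptotic

/-! ### The balanced sparse regime -/

section Regime

theorem factorialMoment_zero {n : ℕ} (π : PMF (Fin (n + 1))) : factorialMoment π 0 = 1 := by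
  have h := π.tsum_coe
  rw [tsum_fintype] at h
  simp only [factorialMoment, Nat.descFactorial_zero, Nat.cast_one, one_mul]
  rw [← ENNReal.toReal_sum fun x _ => π.apply_ne_top x, h, ENNReal.toReal_one]

theorem descFactorial_five_le (x : ℕ) : x.descFactorial 5 ≤ 120 + x.descFactorial 6 := by
  rcases le_or_gt 6 x with h | h
  · rw [Nat.descFactorial_succ x 5]
    have : 1 * x.descFactorial 5 ≤ (x - 5) * x.descFactorial 5 :=
      Nat.mul_le_mul_right _ (by omega)
    omega
  · interval_cases x <;> decide

theorem factorialMoment_five_le {n : ℕ} (π : PMF (Fin (n + 1))) :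
    factorialMoment π 5 ≤ 120 + factorialMoment π 6 := by
  have h0 := factorialMoment_zero π
  simp only [factorialMoment, Nat.descFactorial_zero, Nat.cast_one, one_mul] at h0 ⊢
  calc _ ≤ ∑ x : Fin (n + 1), (120 * (π x).toReal
          + ((x : ℕ).descFactorial 6 : ℝ) * (π x).toReal) := by
        refine Finset.sum_le_sum fun x _ => ?_
        rw [← add_mul]
        refine mul_le_mul_of_nonneg_right ?_ ENNReal.toReal_nonneg
        exact_mod_cast descFactorial_five_le x
    _ = _ := by rw [Finset.sum_add_distrib, ← Finset.mul_sum, h0, mul_one]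

theorem pow_le_two_pow_mul_descFactorial {x r : ℕ} (h : 2 * r ≤ x) :
    (x : ℝ) ^ r ≤ 2 ^ r * (x.descFactorial r : ℝ) := by
  have h1 := Nat.pow_sub_le_descFactorial x r
  have h2 : x ^ r ≤ 2 ^ r * x.descFactorial r := by
    calc x ^ r ≤ (2 * (x + 1 - r)) ^ r := Nat.pow_le_pow_left (by omega) r
      _ = 2 ^ r * (x + 1 - r) ^ r := by rw [mul_pow]
      _ ≤ _ := Nat.mul_le_mul_left _ h1
  exact_mod_cast h2

/-- The constant `2 ^ r` comes from `(n)_r ≥ (n / 2) ^ r`, valid for `n ≥ 2 r`. -/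
theorem coverProb_le {n : ℕ} (π : PMF (Fin (n + 1))) {r : ℕ} (h : 2 * r ≤ n) (hn : 0 < n) :
    coverProb π r ≤ 2 ^ r * factorialMoment π r / (n : ℝ) ^ r := by
  have hd : (0 : ℝ) < n.descFactorial r := by
    exact_mod_cast Nat.descFactorial_pos.2 (by omega)
  have hn' : (0 : ℝ) < n := by exact_mod_cast hn
  rw [coverProb, div_le_div_iff₀ hd (by positivity)]
  have := mul_le_mul_of_nonneg_left (pow_le_two_pow_mul_descFactorial h)
    (factorialMoment_nonneg π r)
  linarith

theorem le_coverProb {n : ℕ} (π : PMF (Fin (n + 1))) {r : ℕ} (h : r ≤ n) :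
    factorialMoment π r / (n : ℝ) ^ r ≤ coverProb π r := by
  have hd : (0 : ℝ) < n.descFactorial r := by
    exact_mod_cast Nat.descFactorial_pos.2 h
  refine div_le_div_of_nonneg_left (factorialMoment_nonneg π r) hd ?_
  exact_mod_cast Nat.descFactorial_le_pow _ _

theorem exists_eventually_le_of_tendsto {u : ℕ → ℝ} (h : ∃ c : ℝ, c ≠ 0 ∧ Tendsto u atTop (𝓝 c)) :
    ∃ c : ℝ, ∀ᶠ ν in atTop, u ν ≤ c := by
  obtain ⟨c, -, hc⟩ := h
  exact ⟨c + 1, (hc.eventually_lt_const (lt_add_one c)).mono fun _ => le_of_lt⟩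

theorem exists_eventually_ge_of_tendsto {u : ℕ → ℝ} (h0 : ∀ ν, 0 ≤ u ν)
    (h : ∃ c : ℝ, c ≠ 0 ∧ Tendsto u atTop (𝓝 c)) :
    ∃ c : ℝ, 0 < c ∧ ∀ᶠ ν in atTop, c ≤ u ν := by
  obtain ⟨c, hc0, hc⟩ := h
  have hpos : 0 < c := lt_of_le_of_ne (ge_of_tendsto' hc h0) hc0.symm
  exact ⟨c / 2, by positivity,
    (hc.eventually_const_lt (half_lt_self hpos)).mono fun _ => le_of_lt⟩

variable {n m : ℕ → ℕ} {π : ∀ ν, PMF (Fin (n ν + 1))} {q : ℕ → unitInterval}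

theorem exists_sparseBound (hn : Tendsto n atTop atTop)
    (hratio : ∃ c : ℝ, c ≠ 0 ∧ Tendsto (fun ν => (m ν : ℝ) / (n ν : ℝ)) atTop (𝓝 c)) {R : ℕ}
    (hmom : ∀ r ≤ R, ∃ c : ℝ, ∀ᶠ ν in atTop, factorialMoment (π ν) r ≤ c) :
    ∃ K : ℝ, 1 ≤ K ∧ ∀ᶠ ν in atTop, SparseBound (π ν) (m ν) K R := by
  have hmom' : ∀ r : ℕ, ∃ c : ℝ, r ≤ R → ∀ᶠ ν in atTop, factorialMoment (π ν) r ≤ c := by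
    intro r
    by_cases hr : r ≤ R
    · obtain ⟨c, hc⟩ := hmom r hr
      exact ⟨c, fun _ => hc⟩
    · exact ⟨0, fun h => absurd h hr⟩
  choose M hM using hmom'
  obtain ⟨c, hc⟩ := exists_eventually_le_of_tendsto hratio
  set K : ℝ := 1 + |c| + ∑ r ∈ Finset.range (R + 1), 2 ^ r * |M r| with hK
  have hsum0 : 0 ≤ ∑ r ∈ Finset.range (R + 1), 2 ^ r * |M r| :=
    Finset.sum_nonneg fun r _ => by positivity
  have hall : ∀ᶠ ν in atTop, ∀ r ∈ Finset.range (R + 1), factorialMoment (π ν) r ≤ M r := by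
    rw [Filter.eventually_all_finset]
    exact fun r hr => hM r (Nat.le_of_lt_succ (Finset.mem_range.1 hr))
  refine ⟨K, by linarith [abs_nonneg c], ?_⟩
  filter_upwards [hc, hall, hn.eventually_gt_atTop (2 * R)] with ν h1 h2 h3
  have hpos : 0 < n ν := by omega
  have hpos' : (0 : ℝ) < n ν := by exact_mod_cast hpos
  refine ⟨hpos, by linarith [abs_nonneg c], ?_, fun r hr => ?_⟩
  · rw [div_le_iff₀ hpos'] at h1
    refine h1.trans (mul_le_mul_of_nonneg_right ?_ hpos'.le)
    linarith [le_abs_self c]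
  · have hr' : r ∈ Finset.range (R + 1) := Finset.mem_range.2 (Nat.lt_succ_of_le hr)
    refine (coverProb_le (π ν) (by omega) hpos).trans
      (div_le_div_of_nonneg_right ?_ (by positivity))
    have e1 : 2 ^ r * factorialMoment (π ν) r ≤ 2 ^ r * |M r| :=
      mul_le_mul_of_nonneg_left ((h2 r hr').trans (le_abs_self _)) (by positivity)
    have e2 : 2 ^ r * |M r| ≤ ∑ r ∈ Finset.range (R + 1), 2 ^ r * |M r| :=
      Finset.single_le_sum (f := fun r => (2 : ℝ) ^ r * |M r|) (fun r _ => by positivity) hr'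
    linarith [abs_nonneg c]

/-- The mean number of labelled copies inside one layer is at least of order `n₀ ^ r / n ^ (r - 1)`.
-/
theorem exists_mean_lower_bound {n₀ : ℕ → ℕ} (hn : Tendsto n atTop atTop)
    (hbal : BalancedSparse n m π q) {r : ℕ}
    (hmom : ∃ c : ℝ, c ≠ 0 ∧ Tendsto (fun ν => factorialMoment (π ν) (r + 1)) atTop (𝓝 c))
    (hn₀ : Tendsto n₀ atTop atTop) (e : ℕ) :
    ∃ c : ℝ, 0 < c ∧ ∀ᶠ ν in atTop, c * ((n₀ ν : ℝ) ^ (r + 1) / (n ν : ℝ) ^ r)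
      ≤ m ν * ((n₀ ν).descFactorial (r + 1) * (coverProb (π ν) (r + 1) * (q ν : ℝ) ^ e)) := by
  obtain ⟨c₁, hc₁, h₁⟩ := exists_eventually_ge_of_tendsto (fun ν => by positivity) hbal.ratio
  obtain ⟨c₂, hc₂, h₂⟩ :=
    exists_eventually_ge_of_tendsto (fun ν => factorialMoment_nonneg (π ν) _) hmom
  obtain ⟨c₃, hc₃, h₃⟩ := exists_eventually_ge_of_tendsto (fun ν => (q ν).2.1) hbal.link_prob
  refine ⟨c₁ * (c₂ * c₃ ^ e) / 2 ^ (r + 1), by positivity, ?_⟩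
  filter_upwards [h₁, h₂, h₃, hn.eventually_gt_atTop (r + 1),
    hn₀.eventually_ge_atTop (2 * (r + 1))] with ν e₁ e₂ e₃ hν hν₀
  have hpos : (0 : ℝ) < n ν := by
    have : 0 < n ν := by omega
    exact_mod_cast this
  rw [le_div_iff₀ hpos] at e₁
  have e₄ := pow_le_two_pow_mul_descFactorial hν₀
  have e₅ : c₂ / (n ν : ℝ) ^ (r + 1) ≤ coverProb (π ν) (r + 1) :=
    (div_le_div_of_nonneg_right e₂ (by positivity)).trans (le_coverProb (π ν) hν.le)
  have e₆ : (n₀ ν : ℝ) ^ (r + 1) / 2 ^ (r + 1) ≤ ((n₀ ν).descFactorial (r + 1) : ℝ) := by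
    rw [div_le_iff₀ (by positivity)]
    linarith
  calc c₁ * (c₂ * c₃ ^ e) / 2 ^ (r + 1) * ((n₀ ν : ℝ) ^ (r + 1) / (n ν : ℝ) ^ r)
      = c₁ * n ν * ((n₀ ν : ℝ) ^ (r + 1) / 2 ^ (r + 1)
        * (c₂ / (n ν : ℝ) ^ (r + 1) * c₃ ^ e)) := by field_simp; ring
    _ ≤ _ := by
        refine mul_le_mul e₁ (mul_le_mul e₆ (mul_le_mul e₅ (pow_le_pow_left₀ hc₃.le e₃ e)
          (by positivity) (coverProb_nonneg _ _)) (by positivity) (by positivity))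
          (by positivity) (by positivity)

end Regime

/-! ### Laws of large numbers for the counts -/

section Counts

variable {n m n₀ : ℕ → ℕ} {π : ∀ ν, PMF (Fin (n ν + 1))} {q : ℕ → unitInterval}

/-- Concentration on the scale `a = n₀ ^ (r + 1) / n ^ r → ∞`, together with the order of the mean
number of copies inside one layer, yields the law of large numbers for copies of `H`. -/
theorem eqOneAddLittleOPMean_labelledCount {S : ∀ ν, Finset (Fin (n ν))}
    (hS : ∀ ν, (S ν).card = n₀ ν) (hn : Tendsto n atTop atTop) (hn₀ : Tendsto n₀ atTop atTop)
    (hbal : BalancedSparse n m π q) {r : ℕ} {H : SimpleGraph (Fin (r + 1))}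
    (hH : ∀ a, ∃ b, H.Adj a b)
    (hmom : ∃ c : ℝ, c ≠ 0 ∧ Tendsto (fun ν => factorialMoment (π ν) (r + 1)) atTop (𝓝 c))
    (ha : Tendsto (fun ν => (n₀ ν : ℝ) ^ (r + 1) / (n ν : ℝ) ^ r) atTop atTop)
    {D : ℝ} (hD : 0 ≤ D)
    (h : ∀ᶠ ν in atTop,
      meanAbsDev (modelMeasure (n ν) (m ν) (π ν) (q ν))
          (fun ω => (labelledCount (S ν) H (modelGraph ω) : ℝ))
        ≤ D * (√(((S ν).card : ℝ) ^ (r + 1) / (n ν : ℝ) ^ r)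
          + ((S ν).card : ℝ) ^ (r + 1) / (n ν : ℝ) ^ (r + 1)) ∧
      ∫ ω, ∑ k : Fin (m ν), (labelledCount (S ν) H (layerGraph (layer k ω)) : ℝ)
          ∂modelMeasure (n ν) (m ν) (π ν) (q ν)
          - D * (((S ν).card : ℝ) ^ (r + 1) / (n ν : ℝ) ^ (r + 1))
        ≤ ∫ ω, (labelledCount (S ν) H (modelGraph ω) : ℝ)
          ∂modelMeasure (n ν) (m ν) (π ν) (q ν)) :
    EqOneAddLittleOPMean (fun ν => modelMeasure (n ν) (m ν) (π ν) (q ν))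
      (fun ν ω => (labelledCount (S ν) H (modelGraph ω) : ℝ)) := by
  classical
  obtain ⟨c, hc, hmean⟩ := exists_mean_lower_bound hn hbal hmom hn₀ H.edgeFinset.card
  refine eqOneAddLittleOPMean_of_meanAbsDev _ (fun ν ω => Nat.cast_nonneg _) ?_
  have hs : ∀ ν, (n₀ ν : ℝ) ^ (r + 1) / (n ν : ℝ) ^ r / (n ν : ℝ)
      = (n₀ ν : ℝ) ^ (r + 1) / (n ν : ℝ) ^ (r + 1) := fun ν => by
    rw [div_div, ← pow_succ]
  refine tendsto_div_of_deviation_le (s := fun ν => (n ν : ℝ)) hD hc ha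
    (tendsto_natCast_atTop_atTop.comp hn)
    (fun ν => integral_nonneg fun _ => abs_nonneg _) ?_ ?_
  · filter_upwards [h] with ν hν
    rw [hs, ← hS]
    exact hν.1
  · filter_upwards [h, hmean] with ν hν hν'
    have := hν.2
    rw [integral_labelledCount_layers (q ν) hH, hS] at this
    rw [hs]
    linarith

theorem EqOneAddLittleOPMean.of_labelledCount {P : ∀ ν, Measure (ModelSpace (n ν) (m ν))}
    {S : ∀ ν, Finset (Fin (n ν))} {H : SimpleGraph (Fin 3)}
    (h : EqOneAddLittleOPMean P fun ν ω => (labelledCount (S ν) H (modelGraph ω) : ℝ)) :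
    EqOneAddLittleOPMean P fun ν ω => ((observedGraph (S ν) ω).copyCount H : ℝ) := by
  have : Finite (H ≃g H) :=
    Finite.of_injective (fun σ => (σ : Fin 3 → Fin 3)) DFunLike.coe_injective
  have : Nonempty (H ≃g H) := ⟨RelIso.refl _⟩
  refine EqOneAddLittleOPMean.of_const_mul (c := (Nat.card (H ≃g H) : ℝ))
    (by exact_mod_cast Nat.card_pos.ne') ?_
  convert h using 3 with ν ω
  rw [← labelledCopyCount_induce, labelledCopyCount_eq_copyCount_mul, Nat.cast_mul, mul_comm]

end Counts

theorem theorem1 (n m n₀ : ℕ → ℕ) (π : ∀ ν, PMF (Fin (n ν + 1))) (q : ℕ → unitInterval)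
    (S : ∀ ν, Finset (Fin (n ν))) (hS : ∀ ν, (S ν).card = n₀ ν)
    (hn : Tendsto n atTop atTop)
    (hbal : BalancedSparse n m π q)
    (hfour : ∃ c : ℝ, 0 < c ∧ ∀ ν, factorialMoment (π ν) 4 ≤ c)
    (hn₀ : (fun ν => (n ν : ℝ) ^ (1 / 2 : ℝ)) =o[atTop] fun ν => (n₀ ν : ℝ)) :
    EqOneAddLittleOPMean (fun ν => modelMeasure (n ν) (m ν) (π ν) (q ν))
        (fun ν => linkCount (S ν)) ∧
      ((∃ c : ℝ, 0 < c ∧ ∀ ν, factorialMoment (π ν) 6 ≤ c) →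
        ((fun ν => (n ν : ℝ) ^ (2 / 3 : ℝ)) =o[atTop] fun ν => (n₀ ν : ℝ)) →
        EqOneAddLittleOPMean (fun ν => modelMeasure (n ν) (m ν) (π ν) (q ν))
            (fun ν => twoStarCount (S ν)) ∧
          EqOneAddLittleOPMean (fun ν => modelMeasure (n ν) (m ν) (π ν) (q ν))
            (fun ν => triangleCount (S ν))) := by
  have hmom : ∀ r ≤ 4, ∃ c : ℝ, ∀ᶠ ν in atTop, factorialMoment (π ν) r ≤ c := by
    intro r hr
    interval_cases r
    · exact ⟨1, .of_forall fun ν => (factorialMoment_zero (π ν)).le⟩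
    · exact exists_eventually_le_of_tendsto hbal.moment_one
    · exact exists_eventually_le_of_tendsto hbal.moment_two
    · exact exists_eventually_le_of_tendsto hbal.moment_three
    · exact hfour.imp fun c hc => .of_forall hc.2
  obtain ⟨K, hK, hbound⟩ := exists_sparseBound hn hbal.ratio hmom
  have ha : Tendsto (fun ν => (n₀ ν : ℝ) ^ 2 / (n ν : ℝ) ^ 1) atTop atTop :=
    tendsto_pow_div_pow_atTop hn two_ne_zero (by simpa using hn₀)
  have hn₀' : Tendsto n₀ atTop atTop := by
    rw [← tendsto_natCast_atTop_iff (R := ℝ)]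
    refine tendsto_atTop_mono (fun ν => ?_) ha
    -- `n₀ ^ 2 / n ≤ n₀` because at most all `n` nodes are observed.
    have : (n₀ ν : ℝ) / n ν ≤ 1 := hS ν ▸ card_div_le_one
    calc (n₀ ν : ℝ) ^ 2 / (n ν : ℝ) ^ 1 = (n₀ ν : ℝ) * ((n₀ ν : ℝ) / n ν) := by ring
      _ ≤ n₀ ν := mul_le_of_le_one_right (Nat.cast_nonneg _) this
  constructor
  · refine EqOneAddLittleOPMean.of_const_mul (c := 2) two_ne_zero ?_
    have h := eqOneAddLittleOPMean_labelledCount hS hn hn₀' hbal top_two_no_isolated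
      hbal.moment_two ha (D := 16 * K ^ 6) (by positivity)
      (hbound.mono fun ν h => by simpa using h.linkCount_concentration (S := S ν) (q ν))
    convert h using 3 with ν ω
    rw [← labelledCopyCount_induce, ← two_mul_ncard_edgeSet, linkCount]
    push_cast
    rfl
  · intro hsix hn₀₃
    have hmom' : ∀ r ≤ 6, ∃ c : ℝ, ∀ᶠ ν in atTop, factorialMoment (π ν) r ≤ c := by
      obtain ⟨c, -, hc⟩ := hsix
      intro r hr
      rcases Nat.lt_or_ge 4 r with h | h
      · interval_cases r
        · exact ⟨120 + c, .of_forall fun ν =>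
            (factorialMoment_five_le (π ν)).trans (by linarith [hc ν])⟩
        · exact ⟨c, .of_forall hc⟩
      · exact hmom r h
    obtain ⟨K', hK', hbound'⟩ := exists_sparseBound hn hbal.ratio hmom'
    have ha' : Tendsto (fun ν => (n₀ ν : ℝ) ^ 3 / (n ν : ℝ) ^ 2) atTop atTop :=
      tendsto_pow_div_pow_atTop hn three_ne_zero (by simpa using hn₀₃)
    constructor
    · exact (eqOneAddLittleOPMean_labelledCount hS hn hn₀' hbal star_no_isolated
        hbal.moment_three ha' (D := 16 * K' ^ 6) (by positivity)
        (hbound'.mono fun ν h => h.twoStarCount_concentration (S := S ν) (q ν))).of_labelledCount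
    · exact (eqOneAddLittleOPMean_labelledCount hS hn hn₀' hbal top_three_no_isolated
        hbal.moment_three ha' (D := 16 * K' ^ 6) (by positivity)
        (hbound'.mono fun ν h => h.triangleCount_concentration (S := S ν) (q ν))).of_labelledCount
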